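/- Conventions. A multivalued map $F\colon X\to Y$ assigns to each $x\in X$ a nonempty subset $F(x)\subset Y$; its graph is $\Gamma_F=\{(x,y)\in X\times Y : y\in F(x)\}$, and $\Gamma_F(K)=\{(x,y)\in\Gamma_F : x\in K\}$ for $K\subset X$. $F$ is called compact if every $F(x)$ is compact and $\{x : F(x)\subset U\}$ is open in $X$ for every open $U\subset Y$. ANR means absolute neighborhood retract for separable metrizable spaces, and $\dim$ is the Lebesgue covering dimension. A fiberwise transformation $T$ from $F\colon X\to Y$ to $G\colon X\to Y'$ is a continuous map $T\colon\Gamma_F\to\Gamma_G$ with $T(\{x\}\times F(x))\subset\{x\}\times G(x)$ for all $x\in X$; it determines continuous maps $T(x)\colon F(x)\to G(x)$. A multivalued map $F\colon X\to Y$ contains (admits) the singular filtration $\{(F_i,T_i)\}_{i=0}^n$, of length $n$, if each $F_i\colon X\to Y_i$ is a multivalued map to a separable metrizable space $Y_i$ and each $T_i$ is a fiberwise transformation from $F_i$ to $F_{i+1}$, where $F_{n+1}=F$. The filtration is compact if the maps $F_0,\dots,F_n$ are compact. Let $\phi\colon K\to K'$ be a continuous map of compact metrizable spaces. The triple $(K,\phi,K')$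 is approximately $m$-aspheric if, for all embeddings $K\subset Z$, $K'\subset Z'$ into ANRs, every continuous extension $\widetilde\phi\colon OK\to Z'$ of $\phi$ to a neighborhood $OK$ of $K$ in $Z$ and every neighborhood $U$ of $K'$ in $Z'$, there is a neighborhood $V\subset OK$ of $K$ such that for every continuous $f\colon S^m\to V$ the map $\widetilde\phi\circ f$ takes values in $U$ and is null-homotopic in $U$. The compactum $K$ is approximately $m$-aspheric if, for every embedding of $K$ into an ANR $Z$ and every neighborhood $U$ of $K$ in $Z$, there is a neighborhood $V$ of $K$ such that every continuous $f\colon S^m\to V$ takes values in $U$ and is null-homotopic in $U$. A compact singular filtration $\{(F_i,T_i)\}_{i=0}^n$ is approximately connected if for every $x\in X$ and every $0\le i<n$ the triple $(F_i(x),T_i(x),F_{i+1}(x))$ is approximately $i$-aspheric; it is approximately $\infty$-connected if, in addition, $F_n(x)$ is approximately $k$-aspheric for all $x\in X$ and all $k\ge n$. Theorem. (1) Let $H\colon X\to Y$ be a multivalued map of a metric space $X$ to a Banach space $Y$. If $\dim X\le n$ and $H$ contains an approximately connected singular filtration $\{(H_i\colon X\to Y_i,T_i)\}_{i=0}^n$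 of compact maps, then every neighborhood of $\Gamma_H$ in $X\times Y$ contains the graph of a continuous single-valued map $h\colon X\to Y$. (2) Let $X$ and $Y$ be separable metrizable ANRs and let $F\colon X\to Y$ be a compact multivalued map that admits a compact approximately $\infty$-connected singular filtration (of some finite length $n\ge 0$). Then for every compact $K\subset X$ every neighborhood of $\Gamma_F(K)$ in $X\times Y$ contains the graph of a continuous single-valued map $f\colon K\to Y$. -/

import Mathlib

open Topology Set

universe u v w

/-- `dim X ≤ n` for the Lebesgue covering dimension: every open cover has an open refinement
such that no point lies in more than `n + 1` members of it. -/
def CoveringDimLE (X : Type u) [TopologicalSpace X] (n : ℕ) : Prop :=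
  ∀ 𝒰 : Set (Set X), (∀ A ∈ 𝒰, IsOpen A) → ⋃₀ 𝒰 = univ →
    ∃ 𝒱 : Set (Set X), (∀ B ∈ 𝒱, IsOpen B) ∧ ⋃₀ 𝒱 = univ ∧ (∀ B ∈ 𝒱, ∃ A ∈ 𝒰, B ⊆ A) ∧
      ∀ x : X, {B ∈ 𝒱 | x ∈ B}.encard ≤ n + 1

/-- Absolute neighborhood retracts in the class of separable metrizable spaces: whenever `Z` is
embedded as a closed subset of a separable metrizable space `W`, it is a retract of an open
neighborhood in `W`. -/
structure IsANR (Z : Type u) [TopologicalSpace Z] : Prop where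
  metrizable : TopologicalSpace.MetrizableSpace Z
  separable : TopologicalSpace.SeparableSpace Z
  retract : ∀ (W : Type u) [TopologicalSpace W] [TopologicalSpace.MetrizableSpace W]
    [TopologicalSpace.SeparableSpace W] (e : Z → W), IsClosedEmbedding e →
      ∃ O : Set W, IsOpen O ∧ range e ⊆ O ∧
        ∃ r : C(O, Z), ∀ (z : Z) (hz : e z ∈ O), r ⟨e z, hz⟩ = z

/-- The standard sphere `S^m`. -/
abbrev StdSphere (m : ℕ) : Type := Metric.sphere (0 : EuclideanSpace ℝ (Fin (m + 1))) 1

/-- The singular pair `(K, φ, K')` is approximately `m`-aspheric: for all embeddings `e`, `e'` of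
`K`, `K'` into ANR-spaces `Z`, `Z'`, every extension `ψ : O → Z'` of `φ` to a neighborhood `O` of
`K` in `Z` and every neighborhood `U` of `K'` in `Z'` there is a neighborhood `V ⊆ O` of `K` such
that for every `f : S^m → V` the composition `ψ ∘ f` maps to `U` and is null-homotopic in `U`. -/
def ApproxAsphericPair (m : ℕ) {K : Type u} {K' : Type v} [TopologicalSpace K]
    [TopologicalSpace K'] (φ : C(K, K')) : Prop :=
  ∀ (Z : Type u) [TopologicalSpace Z] (Z' : Type v) [TopologicalSpace Z'],
    IsANR Z → IsANR Z' →
    ∀ (e : K → Z) (e' : K' → Z'), IsEmbedding e → IsEmbedding e' →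
    ∀ O ∈ 𝓝ˢ (range e), ∀ ψ : C(O, Z'),
      (∀ (k : K) (hk : e k ∈ O), ψ ⟨e k, hk⟩ = e' (φ k)) →
    ∀ U ∈ 𝓝ˢ (range e'), ∃ V ∈ 𝓝ˢ (range e), V ⊆ O ∧
      ∀ f : C(StdSphere m, O), (∀ s, (f s : Z) ∈ V) →
        ∃ g : C(StdSphere m, U), (∀ s, (g s : Z') = ψ (f s)) ∧ g.Nullhomotopic

/-- The compactum `K` is approximately `m`-aspheric: for every embedding `e` of `K` into an
ANR-space `Z`, every neighborhood `U` of `K` in `Z` contains the images of all maps of `S^m` into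
some neighborhood `V` of `K`, and these maps are null-homotopic in `U`. -/
def ApproxAspheric (m : ℕ) (K : Type u) [TopologicalSpace K] : Prop :=
  ∀ (Z : Type u) [TopologicalSpace Z], IsANR Z → ∀ e : K → Z, IsEmbedding e →
    ∀ U ∈ 𝓝ˢ (range e), ∃ V ∈ 𝓝ˢ (range e),
      ∀ f : C(StdSphere m, Z), (∀ s, f s ∈ V) →
        ∃ g : C(StdSphere m, U), (∀ s, (g s : Z) = f s) ∧ g.Nullhomotopic

/-- A multivalued map from `X` to `Y`; point-images are nonempty. -/
structure MultivaluedMap (X : Type u) (Y : Type v) where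
  toFun : X → Set Y
  nonempty_apply : ∀ x, (toFun x).Nonempty

namespace MultivaluedMap

variable {X : Type u} {Y : Type v}

instance : CoeFun (MultivaluedMap X Y) (fun _ => X → Set Y) := ⟨toFun⟩

/-- The part of the graph of `F` over `A`. -/
def graphOn (F : MultivaluedMap X Y) (A : Set X) : Set (X × Y) := {p | p.1 ∈ A ∧ p.2 ∈ F p.1}

/-- The graph of `F`. -/
def graph (F : MultivaluedMap X Y) : Set (X × Y) := {p | p.2 ∈ F p.1}

/-- A compact mapping: upper semicontinuous with compact point-images. -/
structure IsCompactMap [TopologicalSpace X] [TopologicalSpace Y] (F : MultivaluedMap X Y) :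
    Prop where
  upperSemicontinuous : ∀ U : Set Y, IsOpen U → IsOpen {x | F x ⊆ U}
  isCompact_apply : ∀ x, IsCompact (F x)

end MultivaluedMap

/-- A fiberwise transformation from `F` to `G`: a continuous map of graphs over the identity
of `X`. -/
structure FiberwiseTransformation {X : Type u} {Y : Type v} {Y' : Type w} [TopologicalSpace X]
    [TopologicalSpace Y] [TopologicalSpace Y'] (F : MultivaluedMap X Y)
    (G : MultivaluedMap X Y') where
  toMap : C(F.graph, G.graph)
  fst_eq : ∀ p : F.graph, (toMap p : X × Y').1 = (p : X × Y).1

namespace FiberwiseTransformation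

variable {X : Type u} {Y : Type v} {Y' : Type w} [TopologicalSpace X] [TopologicalSpace Y]
  [TopologicalSpace Y'] {F : MultivaluedMap X Y} {G : MultivaluedMap X Y'}

theorem snd_mem (T : FiberwiseTransformation F G) (p : F.graph) :
    (T.toMap p : X × Y').2 ∈ G (p : X × Y).1 := by
  rw [← T.fst_eq p]
  exact (T.toMap p).2

/-- The fiber `T(x) : F(x) → G(x)` over the point `x`. -/
def fiber (T : FiberwiseTransformation F G) (x : X) : C(F x, G x) where
  toFun y := ⟨(T.toMap ⟨(x, y), y.2⟩ : X × Y').2, T.snd_mem ⟨(x, y), y.2⟩⟩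
  continuous_toFun := by fun_prop

end FiberwiseTransformation

/-- A singular filtration `{(F_i : X → Y_i, T_i)}` for `i = 0, …, n` of multivalued maps contained
in `F`: for `i < n` the fiberwise transformation `T_i = trans i` goes from `F_i` to `F_{i+1}`, and
`T_n = transLast` goes from `F_n` to `F`. The `Y_i` are separable metrizable spaces. -/
structure SingularFiltration {X : Type u} {Y : Type v} [TopologicalSpace X] [TopologicalSpace Y]
    (F : MultivaluedMap X Y) (n : ℕ) where
  space : Fin (n + 1) → Type w
  [top : ∀ i, TopologicalSpace (space i)]
  [metrizable : ∀ i, TopologicalSpace.MetrizableSpace (space i)]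
  [separable : ∀ i, TopologicalSpace.SeparableSpace (space i)]
  map : ∀ i, MultivaluedMap X (space i)
  trans : ∀ i : Fin n, FiberwiseTransformation (map i.castSucc) (map i.succ)
  transLast : FiberwiseTransformation (map (Fin.last n)) F

namespace SingularFiltration

attribute [instance] SingularFiltration.top

variable {X : Type u} {Y : Type v} [TopologicalSpace X] [TopologicalSpace Y]
  {F : MultivaluedMap X Y} {n : ℕ}

/-- All members of the filtration are compact mappings. -/
def IsCompactFiltration (ℱ : SingularFiltration.{u, v, w} F n) : Prop :=
  ∀ i, (ℱ.map i).IsCompactMap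

/-- Approximate connectedness: for `i < n` and every point `x`, the singular pair
`(F_i(x), T_i(x), F_{i+1}(x))` is approximately `i`-aspheric. -/
def IsApproxConnected (ℱ : SingularFiltration.{u, v, w} F n) : Prop :=
  ∀ (x : X) (i : Fin n), ApproxAsphericPair (i : ℕ) ((ℱ.trans i).fiber x)

/-- Approximate `∞`-connectedness: moreover, the point-images `F_n(x)` are approximately
`k`-aspheric for all `k ≥ n`. -/
def IsApproxInftyConnected (ℱ : SingularFiltration.{u, v, w} F n) : Prop :=
  ℱ.IsApproxConnected ∧
    ∀ (x : X) (k : ℕ), n ≤ k → ApproxAspheric k (ℱ.map (Fin.last n) x)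

end SingularFiltration

/-!
The values of the filtration are embedded in `ℝ^ω`, and by Tietze's theorem the transformations
extend to continuous maps of `X × ℝ^ω`, under which spheres near a value of one map can be filled
near the value of the next. Over a sufficiently fine open cover of `X` of order `n + 1`, a map of
its nerve is therefore built by induction on skeleta, filling spheres one dimension at a time;
passing from one point of `X` to a nearby one costs an arbitrarily small error, which the convexity
of `ℝ^ω` absorbs. Composed with a partition of unity it gives a map whose graph lies near that of
the last member of the filtration, and the last transformation, extended to a neighborhood of that
graph, carries it to an approximation of the given map.

When `dim X` is infinite but `K` is compact, the inclusion of `K` into the ANR `X` is approximated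
by a map through a compact subset of some `ℝ^N`. Its covering dimension is finite, and the
filtration, pulled back to it, is prolonged to the required length by identities.
-/

section Spheres

/-- The map `f` takes values in `U` and is null-homotopic as a map to `U`. -/
def NullhomotopicIn {S E : Type*} [TopologicalSpace S] [TopologicalSpace E] (f : C(S, E))
    (U : Set E) : Prop :=
  ∃ g : C(S, U), (∀ s, (g s : E) = f s) ∧ g.Nullhomotopic

namespace NullhomotopicIn

variable {S E E' : Type*} [TopologicalSpace S] [TopologicalSpace E] [TopologicalSpace E']
  {f f' : C(S, E)} {U : Set E}

theorem comp_right {U' : Set E'} (hf : NullhomotopicIn f U) (h : C(E, E')) (hU : MapsTo h U U') :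
    NullhomotopicIn (h.comp f) U' := by
  obtain ⟨g, hg, hnull⟩ := hf
  let hUU' : C(U, U') := ⟨hU.restrict, h.continuous.restrict hU⟩
  exact ⟨hUU'.comp g, fun s => congrArg h (hg s), hnull.comp_right hUU'⟩

theorem mono {U' : Set E} (hf : NullhomotopicIn f U) (hU : U ⊆ U') : NullhomotopicIn f U' :=
  hf.comp_right (ContinuousMap.id E) hU

theorem of_homotopy (hf' : NullhomotopicIn f' U) (F : f.Homotopy f') (hF : ∀ p, F p ∈ U) :
    NullhomotopicIn f U := by
  obtain ⟨g, hg, z, hgz⟩ := hf'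
  have hfU : ∀ s, f s ∈ U := fun s => by simpa using hF (0, s)
  let fU : C(S, U) := ⟨fun s => ⟨f s, hfU s⟩, by fun_prop⟩
  have hfg : fU.Homotopic g := ⟨{
    toFun := fun p => ⟨F p, hF p⟩
    continuous_toFun := by fun_prop
    map_zero_left := fun s => Subtype.ext (F.map_zero_left s)
    map_one_left := fun s => Subtype.ext ((F.map_one_left s).trans (hg s).symm) }⟩
  exact ⟨fU, fun s => rfl, z, hfg.trans hgz⟩

end NullhomotopicIn

variable {V Z : Type*} [NormedAddCommGroup V] [NormedSpace ℝ V] [TopologicalSpace Z]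

theorem inv_norm_smul_mem_sphere {x : V} (hx : x ≠ 0) : ‖x‖⁻¹ • x ∈ Metric.sphere (0 : V) 1 := by
  simp [norm_smul, hx]

theorem continuous_inv_norm_smul : Continuous fun x : ({0}ᶜ : Set V) =>
    (⟨‖(x : V)‖⁻¹ • (x : V), inv_norm_smul_mem_sphere x.2⟩ : Metric.sphere (0 : V) 1) :=
  ((continuous_subtype_val.norm.inv₀ fun x => norm_ne_zero_iff.2 x.2).smul
    continuous_subtype_val).subtype_mk _

theorem exists_extension_of_nullhomotopic {f : C(Metric.sphere (0 : V) 1, Z)}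
    (hf : f.Nullhomotopic) : ∃ F : C(V, Z), ∀ s : Metric.sphere (0 : V) 1, F s = f s := by
  classical
  obtain ⟨z, ⟨H⟩⟩ := hf
  -- `H` run radially: time `0` on the unit sphere, time `1` on the ball of radius `1 / 2`.
  let F : V → Z := fun x =>
    if hx : x = 0 then z
    else H (projIcc 0 1 zero_le_one (2 - 2 * ‖x‖), ⟨‖x‖⁻¹ • x, inv_norm_smul_mem_sphere hx⟩)
  have hF_near_zero : ∀ x, ‖x‖ < 1 / 2 → F x = z := by
    intro x hx
    by_cases h0 : x = 0
    · simp only [F, dif_pos h0]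
    · simp only [F, dif_neg h0, projIcc_of_right_le zero_le_one (show 1 ≤ 2 - 2 * ‖x‖ by linarith)]
      exact H.map_one_left _
  have hF_compl_zero : ContinuousOn F {0}ᶜ := by
    rw [continuousOn_iff_continuous_domRestrict]
    refine Continuous.congr (f := fun x : ({0}ᶜ : Set V) =>
      H (projIcc 0 1 zero_le_one (2 - 2 * ‖(x : V)‖), ⟨_, inv_norm_smul_mem_sphere x.2⟩))
      (H.continuous.comp ((continuous_projIcc.comp (by fun_prop)).prodMk continuous_inv_norm_smul))
      fun x => ?_
    simp only [domRestrict_apply, F, dif_neg (mem_compl_singleton_iff.1 x.2)]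
  refine ⟨⟨F, continuous_iff_continuousAt.2 fun x => ?_⟩, fun s => ?_⟩
  · obtain rfl | hx := eq_or_ne x 0
    · refine continuousAt_const.congr (f := fun _ => z) ?_
      filter_upwards [Metric.ball_mem_nhds (0 : V) one_half_pos] with y hy
      exact (hF_near_zero y (by simpa using hy)).symm
    · exact hF_compl_zero.continuousAt (isOpen_compl_singleton.mem_nhds hx)
  · have hs : ‖(s : V)‖ = 1 := by simp
    have hs0 : (s : V) ≠ 0 := norm_ne_zero_iff.1 (by rw [hs]; exact one_ne_zero)
    have hsnormalize : (⟨_, inv_norm_smul_mem_sphere hs0⟩ : Metric.sphere (0 : V) 1) = s := by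
      ext1; simp [hs]
    have htime : projIcc 0 1 zero_le_one (2 - 2 * ‖(s : V)‖) = 0 :=
      projIcc_of_le_left zero_le_one (by rw [hs]; norm_num)
    simp only [ContinuousMap.coe_mk, F, dif_neg hs0, hsnormalize, htime]
    exact H.map_zero_left s

theorem NullhomotopicIn.exists_extension {f : C(Metric.sphere (0 : V) 1, Z)} {U : Set Z}
    (hf : NullhomotopicIn f U) :
    ∃ F : C(V, Z), (∀ x, F x ∈ U) ∧ ∀ s : Metric.sphere (0 : V) 1, F s = f s := by
  obtain ⟨g, hg, hnull⟩ := hf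
  obtain ⟨G, hG⟩ := exists_extension_of_nullhomotopic hnull
  exact ⟨⟨fun x => G x, by fun_prop⟩, fun x => (G x).2, fun s => by simp [hG, hg]⟩

end Spheres

section Simplices

/-- The closed simplex spanned by the finite set `B` of vertices, in barycentric coordinates. -/
def closedSimplex {ι : Type*} (B : Finset ι) : Set (ι → ℝ) :=
  {s | (∀ v, 0 ≤ s v) ∧ (∀ v ∉ B, s v = 0) ∧ ∑ v ∈ B, s v = 1}

/-- The union of the proper faces of the closed simplex spanned by `B`. -/
def simplexBoundary {ι : Type*} (B : Finset ι) : Set (ι → ℝ) :=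
  {s ∈ closedSimplex B | ∃ v ∈ B, s v = 0}

variable {ι : Type*} {B B' : Finset ι} {s : ι → ℝ}

theorem isClosed_closedSimplex (B : Finset ι) : IsClosed (closedSimplex B) := by
  simp only [closedSimplex, ofPred_and, ofPred_forall]
  refine (isClosed_iInter fun v => isClosed_le continuous_const (continuous_apply v)).inter
    (.inter (isClosed_iInter fun v => isClosed_iInter fun _ =>
      isClosed_eq (continuous_apply v) continuous_const) (isClosed_eq (by fun_prop)
      continuous_const))

theorem subset_of_mem_closedSimplex (hs : s ∈ closedSimplex B) (h : ∀ v ∈ B', s v ≠ 0) :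
    B' ⊆ B := fun v hv => by
  by_contra hvB
  exact h v hv (hs.2.1 v hvB)

theorem exists_ssubset_of_mem_simplexBoundary (hs : s ∈ simplexBoundary B) :
    ∃ B' ⊂ B, s ∈ closedSimplex B' := by
  classical
  obtain ⟨hs, v, hv, hsv⟩ := hs
  refine ⟨B.erase v, Finset.erase_ssubset hv, hs.1, fun w hw => ?_,
    by rw [Finset.sum_erase _ hsv, hs.2.2]⟩
  obtain rfl | hwv := eq_or_ne w v
  · exact hsv
  · exact hs.2.1 w fun hwB => hw (Finset.mem_erase.2 ⟨hwv, hwB⟩)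

theorem continuousOn_simplexBoundary {Z : Type*} [TopologicalSpace Z] {g : (ι → ℝ) → Z}
    (hg : ∀ B' ⊂ B, ContinuousOn g (closedSimplex B')) : ContinuousOn g (simplexBoundary B) := by
  classical
  have hfin : Finite (Iio B) := finite_Iio B
  have hunion : ContinuousOn g (⋃ B' : Iio B, closedSimplex B'.1) :=
    (locallyFinite_of_finite _).continuousOn_iUnion (fun B' => isClosed_closedSimplex B'.1)
      fun B' => hg B' B'.2
  refine hunion.mono fun s hs => ?_
  obtain ⟨B', hB', hsB'⟩ := exists_ssubset_of_mem_simplexBoundary hs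
  exact mem_iUnion.2 ⟨⟨B', hB'⟩, hsB'⟩

theorem nonempty_of_mem_closedSimplex (hs : s ∈ closedSimplex B) : B.Nonempty := by
  rw [Finset.nonempty_iff_ne_empty]
  rintro rfl
  simpa using hs.2.2

theorem finsum_smul_eq_of_mem_closedSimplex {E : Type*} [AddCommGroup E] [Module ℝ E]
    (hs : s ∈ closedSimplex B) (z : ι → E) : ∑ᶠ v, s v • z v = ∑ v ∈ B, s v • z v := by
  refine finsum_eq_sum_of_support_subset _ fun v hv => ?_
  by_contra hvB
  exact hv (by simp [hs.2.1 v hvB])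

theorem mem_frontier_convexHull_range_affineBasis {V : Type*} [NormedAddCommGroup V]
    [NormedSpace ℝ V] [Finite ι] (b : AffineBasis ι ℝ V) {x : V} :
    x ∈ frontier (convexHull ℝ (range b)) ↔ (∀ i, 0 ≤ b.coord i x) ∧ ∃ i, b.coord i x = 0 := by
  have hclosed : IsClosed (convexHull ℝ (range b)) :=
    (finite_range b).isClosed_convexHull ℝ
  rw [hclosed.frontier_eq, b.interior_convexHull, b.convexHull_eq_nonneg_coord]
  simp only [mem_sdiff, mem_ofPred_eq, not_forall, not_lt]
  exact and_congr_right fun h => exists_congr fun i =>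
    ⟨fun hi => hi.antisymm (h i), fun hi => hi.le⟩

section Coordinates

variable {V : Type*} [NormedAddCommGroup V] [NormedSpace ℝ V] (b : AffineBasis B ℝ V)

open Classical in
/-- The barycentric coordinates with respect to an affine basis indexed by the vertices of a
simplex, extended by zero to the other vertices. -/
noncomputable def barycentricCoords (x : V) (v : ι) : ℝ :=
  if hv : v ∈ B then b.coord ⟨v, hv⟩ x else 0

theorem barycentricCoords_coe (x : V) (v : B) : barycentricCoords b x v = b.coord v x :=
  dif_pos v.2

theorem continuous_barycentricCoords [FiniteDimensional ℝ V] :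
    Continuous (barycentricCoords b) := by
  refine continuous_pi fun v => ?_
  by_cases hv : v ∈ B
  · simpa only [barycentricCoords, dif_pos hv] using continuous_barycentric_coord b ⟨v, hv⟩
  · simpa only [barycentricCoords, dif_neg hv] using continuous_const

theorem sum_barycentricCoords_smul (x : V) : ∑ v : B, barycentricCoords b x v • b v = x := by
  simp only [barycentricCoords_coe, b.linear_combination_coord_eq_self]

theorem barycentricCoords_sum_smul (hs : s ∈ closedSimplex B) :
    barycentricCoords b (∑ v : B, s v • b v) = s := by
  have hsum : ∑ v : B, s v = 1 := by rw [Finset.sum_coe_sort, hs.2.2]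
  ext v
  by_cases hv : v ∈ B
  · rw [← Finset.univ.affineCombination_eq_linear_combination b (fun v : B => s v) hsum]
    exact (barycentricCoords_coe b _ ⟨v, hv⟩).trans
      (b.coord_apply_combination_of_mem (Finset.mem_univ _) hsum)
  · rw [hs.2.1 v hv, barycentricCoords, dif_neg hv]

theorem barycentricCoords_mem_simplexBoundary {x : V} :
    barycentricCoords b x ∈ simplexBoundary B ↔ x ∈ frontier (convexHull ℝ (range b)) := by
  have hsum : ∑ v ∈ B, barycentricCoords b x v = 1 := by
    rw [← Finset.sum_coe_sort, ← b.sum_coord_apply_eq_one x]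
    exact Finset.sum_congr rfl fun v _ => barycentricCoords_coe b x v
  rw [mem_frontier_convexHull_range_affineBasis]
  constructor
  · rintro ⟨hmem, v, hv, hxv⟩
    exact ⟨fun w => barycentricCoords_coe b x w ▸ hmem.1 w, ⟨v, hv⟩,
      barycentricCoords_coe b x ⟨v, hv⟩ ▸ hxv⟩
  · rintro ⟨hpos, v, hv⟩
    refine ⟨⟨fun w => ?_, fun w hw => dif_neg hw, hsum⟩, v, v.2, by rwa [barycentricCoords_coe]⟩
    by_cases hw : w ∈ B
    · exact (hpos ⟨w, hw⟩).trans_eq (barycentricCoords_coe b x ⟨w, hw⟩).symm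
    · rw [barycentricCoords, dif_neg hw]

end Coordinates

theorem exists_sphere_parametrization_simplexBoundary {m : ℕ} (hB : B.card = m + 2) :
    ∃ (σ : C(StdSphere m, simplexBoundary B)) (c : C(ι → ℝ, EuclideanSpace ℝ (Fin (m + 1)))),
      Function.Surjective σ ∧ ∀ t, c (σ t) = t := by
  obtain ⟨b⟩ := AffineBasis.exists_affineBasis_of_finiteDimensional (ι := B) (k := ℝ)
    (P := EuclideanSpace ℝ (Fin (m + 1))) (by simpa using hB)
  set Δ := convexHull ℝ (range b)
  obtain ⟨h, -, -, hfrontier⟩ := exists_homeomorph_image_interior_closure_frontier_eq_unitBall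
    (convex_convexHull ℝ (range b)) ⟨_, b.centroid_mem_interior_convexHull⟩
    ((finite_range b).isCompact_convexHull ℝ).isBounded
  have hmem : ∀ t : StdSphere m, h.symm t ∈ frontier Δ := by
    intro t
    obtain ⟨x, hx, hxt⟩ := hfrontier.ge t.2
    rwa [← hxt, h.symm_apply_apply]
  refine ⟨⟨fun t => ⟨barycentricCoords b (h.symm t),
      (barycentricCoords_mem_simplexBoundary b).2 (hmem t)⟩, ?_⟩,
    ⟨fun s => h (∑ v : B, s v • b v), by fun_prop⟩, fun s => ?_, fun t => ?_⟩
  · exact ((continuous_barycentricCoords b).comp (by fun_prop)).subtype_mk _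
  · have hs := barycentricCoords_sum_smul b s.2.1
    refine ⟨⟨h (∑ v : B, s.1 v • b v), hfrontier.le (mem_image_of_mem h ?_)⟩, Subtype.ext ?_⟩
    · rw [← barycentricCoords_mem_simplexBoundary, hs]
      exact s.2
    · simpa using hs
  · exact (congrArg h (sum_barycentricCoords_smul b _)).trans (h.apply_symm_apply t)

theorem exists_extension_of_forall_nullhomotopicIn {Z : Type*} [TopologicalSpace Z] {m : ℕ}
    (hB : B.card = m + 2) {f : C(simplexBoundary B, Z)} {U : Set Z}
    (hf : ∀ σ : C(StdSphere m, simplexBoundary B), NullhomotopicIn (f.comp σ) U) :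
    ∃ F : C(ι → ℝ, Z), (∀ s, F s ∈ U) ∧ ∀ s : simplexBoundary B, F s = f s := by
  obtain ⟨σ, c, hσ, hc⟩ := exists_sphere_parametrization_simplexBoundary hB
  obtain ⟨G, hGU, hG⟩ := (hf σ).exists_extension
  refine ⟨G.comp c, fun s => hGU _, fun s => ?_⟩
  obtain ⟨t, rfl⟩ := hσ s
  rw [ContinuousMap.comp_apply, hc, hG, ContinuousMap.comp_apply]

end Simplices

section Asphericity

theorem sub_mem_of_mem_convexHull {E : Type*} [AddCommGroup E] [Module ℝ E] {ω s : Set E}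
    (hω : Convex ℝ ω) {c : E} (hs : ∀ y ∈ s, y - c ∈ ω) {z : E} (hz : z ∈ convexHull ℝ s) :
    z - c ∈ ω := by
  have hconv : Convex ℝ ((fun z => z - c) ⁻¹' ω) := by
    simpa only [sub_eq_add_neg] using hω.translate_preimage_left (-c)
  exact convexHull_min hs hconv hz

/-- The image under `τ` of every `m`-sphere sufficiently close to `K` is null-homotopic close to
`K'`; in the ambient spaces used below this is what approximate asphericity of a singular pair
becomes. -/
def AsphericAlong {E E' : Type*} [TopologicalSpace E] [TopologicalSpace E'] (m : ℕ) (τ : C(E, E'))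
    (K : Set E) (K' : Set E') : Prop :=
  ∀ U, IsOpen U → K' ⊆ U → ∃ V, IsOpen V ∧ K ⊆ V ∧
    ∀ f : C(StdSphere m, E), (∀ s, f s ∈ V) → NullhomotopicIn (τ.comp f) U

variable {X E E' : Type*} [TopologicalSpace X] [TopologicalSpace E] [AddCommGroup E']
  [Module ℝ E'] [TopologicalSpace E']

/-- Over the neighborhood `N` of a point, every way of averaging the values `T (y, q)`, `y ∈ N`,
carries `V` into `U` and turns the `m`-spheres of `V` into spheres that can be filled in `U`. -/
structure FillsSpheres (m : ℕ) (T : C(X × E, E')) (N : Set X) (V : Set E) (U : Set E') :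
    Prop where
  convexHull_subset : ∀ q ∈ V, convexHull ℝ ((fun y => T (y, q)) '' N) ⊆ U
  nullhomotopicIn : ∀ (f : C(StdSphere m, E)) (φ : C(StdSphere m, E')), (∀ t, f t ∈ V) →
    (∀ t, φ t ∈ convexHull ℝ ((fun y => T (y, f t)) '' N)) → NullhomotopicIn φ U

theorem FillsSpheres.anti {m : ℕ} {T : C(X × E, E')} {N N' : Set X} {V : Set E} {U : Set E'}
    (h : FillsSpheres m T N V U) (hN : N' ⊆ N) : FillsSpheres m T N' V U where
  convexHull_subset q hq := (convexHull_mono (image_mono hN)).trans (h.convexHull_subset q hq)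
  nullhomotopicIn f φ hf hφ :=
    h.nullhomotopicIn f φ hf fun t => convexHull_mono (image_mono hN) (hφ t)

variable [IsTopologicalAddGroup E'] [ContinuousSMul ℝ E']

open scoped Pointwise in
theorem exists_isOpen_convex_add_add_subset [LocallyConvexSpace ℝ E'] {K U : Set E'}
    (hK : IsCompact K) (hU : IsOpen U) (hKU : K ⊆ U) :
    ∃ ω : Set E', IsOpen ω ∧ Convex ℝ ω ∧ 0 ∈ ω ∧ K + ω + ω ⊆ U := by
  obtain ⟨S, hS, hSU⟩ := compact_open_separated_add_right hK hU hKU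
  obtain ⟨S', hS', hSS⟩ := exists_nhds_zero_half hS
  obtain ⟨ω, ⟨hω0, hωo, hωc⟩, hωS⟩ :=
    (LocallyConvexSpace.convex_open_basis_zero ℝ E').mem_iff.1 hS'
  refine ⟨ω, hωo, hωc, hω0, Subset.trans ?_ hSU⟩
  rw [add_assoc]
  refine add_subset_add_left ?_
  rintro _ ⟨d, hd, d', hd', rfl⟩
  exact hSS d (hωS hd) d' (hωS hd')

open scoped Pointwise in
theorem AsphericAlong.exists_fillsSpheres [LocallyConvexSpace ℝ E'] {m : ℕ} {T : C(X × E, E')}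
    {x : X} {K : Set E} {K' : Set E'} (hA : AsphericAlong m (T.curry x) K K') (hK : IsCompact K)
    (hK' : IsCompact K') (hTK : MapsTo (T.curry x) K K') {U : Set E'} (hU : IsOpen U)
    (hKU : K' ⊆ U) :
    ∃ N V, IsOpen N ∧ x ∈ N ∧ IsOpen V ∧ K ⊆ V ∧ FillsSpheres m T N V U := by
  obtain ⟨ω, hωo, hωc, hω0, hωU⟩ := exists_isOpen_convex_add_add_subset hK' hU hKU
  have hKω : K' ⊆ K' + ω := fun k hk => ⟨k, hk, 0, hω0, add_zero k⟩
  have hωU' : K' + ω ⊆ U := fun z hz => hωU ⟨z, hz, 0, hω0, add_zero z⟩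
  obtain ⟨V₀, hV₀, hKV₀, hnull⟩ := hA (K' + ω) hωo.add_left hKω
  obtain ⟨N, V₁, hN, hV₁, hxN, hKV₁, hclose⟩ := generalized_tube_lemma
    (isCompact_singleton (x := x)) hK (n := {p : X × E | T p - T (x, p.2) ∈ ω})
    (hωo.preimage (by fun_prop)) (by rintro ⟨_, q⟩ ⟨rfl, -⟩; simpa using hω0)
  have hhull : ∀ q ∈ V₁, ∀ z ∈ convexHull ℝ ((fun y => T (y, q)) '' N), z - T (x, q) ∈ ω :=
    fun q hq z => sub_mem_of_mem_convexHull hωc <| by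
      rintro _ ⟨y, hy, rfl⟩
      exact hclose (mk_mem_prod hy hq)
  refine ⟨N, V₀ ∩ T.curry x ⁻¹' (K' + ω) ∩ V₁, hN, hxN rfl,
    (hV₀.inter (hωo.add_left.preimage (T.curry x).continuous)).inter hV₁,
    fun q hq => ⟨⟨hKV₀ hq, hKω (hTK hq)⟩, hKV₁ hq⟩, fun q hq z hz => ?_, fun f φ hf hφ => ?_⟩
  · exact hωU ⟨T (x, q), hq.1.2, _, hhull q hq.2 z hz, add_sub_cancel _ _⟩
  · have hτ : NullhomotopicIn ((T.curry x).comp f) U := (hnull f fun t => (hf t).1.1).mono hωU'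
    refine hτ.of_homotopy ⟨⟨fun p => φ p.2 + (p.1 : ℝ) • (T (x, f p.2) - φ p.2), by fun_prop⟩,
      fun t => by simp, fun t => by simp⟩ fun ⟨r, t⟩ => hωU ⟨T (x, f t), (hf t).1.2,
        (1 - (r : ℝ)) • (φ t - T (x, f t)) + (r : ℝ) • 0, ?_, ?_⟩
    · exact hωc (hhull _ (hf t).2 _ (hφ t)) hω0 (sub_nonneg.2 r.2.2) r.2.1 (by ring)
    · change T (x, f t) + _ = φ t + (r : ℝ) • (T (x, f t) - φ t)
      module

end Asphericity

section Covers

variable {X α ι : Type*}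

/-- Barycentric refinement of families of sets: all the members of `O` through a given point lie in
a common member of `N`. -/
def IsBarycentricRefinement (O : ι → Set X) (N : α → Set X) : Prop :=
  ∀ x, ∃ a, ∀ v, x ∈ O v → O v ⊆ N a

theorem IsBarycentricRefinement.mono {O : ι → Set X} {N N' : α → Set X}
    (h : IsBarycentricRefinement O N) (hN : ∀ a, N a ⊆ N' a) : IsBarycentricRefinement O N' :=
  fun x => (h x).imp fun a ha v hv => (ha v hv).trans (hN a)

theorem IsBarycentricRefinement.exists_subset {O : ι → Set X} {N : α → Set X}
    (h : IsBarycentricRefinement O N) {B : Finset ι} (hB : (⋂ v ∈ B, O v).Nonempty) :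
    ∃ a, ∀ v ∈ B, O v ⊆ N a := by
  obtain ⟨x, hx⟩ := hB
  obtain ⟨a, ha⟩ := h x
  exact ⟨a, fun v hv => ha v (mem_iInter₂.1 hx v hv)⟩

theorem exists_ball_forall_ball_subset [PseudoMetricSpace X] {c : α → X} {r : α → ℝ}
    (hr : ∀ a, 0 < r a) (hr1 : ∀ a, r a ≤ 1) {x : X} {a : α}
    (hx : x ∈ Metric.ball (c a) (r a / 5)) :
    ∃ z, ∀ b, x ∈ Metric.ball (c b) (r b / 5) →
      Metric.ball (c b) (r b / 5) ⊆ Metric.ball (c z) (r z) := by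
  -- A ball through `x` whose radius is at least half the supremum contains all the others.
  set R : Set ℝ := r '' {b | x ∈ Metric.ball (c b) (r b / 5)}
  have hbdd : BddAbove R := ⟨1, by rintro _ ⟨b, -, rfl⟩; exact hr1 b⟩
  have hpos : 0 < sSup R := (hr a).trans_le (le_csSup hbdd ⟨a, hx, rfl⟩)
  obtain ⟨_, ⟨z, hz, rfl⟩, hRz⟩ :=
    exists_lt_of_lt_csSup (s := R) ⟨_, a, hx, rfl⟩ (half_lt_self hpos)
  refine ⟨z, fun b hb p hp => ?_⟩
  have hrb : r b ≤ sSup R := le_csSup hbdd ⟨b, hb, rfl⟩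
  rw [mem_ofPred_eq, Metric.mem_ball] at hz
  rw [Metric.mem_ball'] at hb
  rw [Metric.mem_ball] at hp ⊢
  linarith [dist_triangle4 p (c b) x (c z)]

theorem exists_isOpen_nhds_barycentric [TopologicalSpace X]
    [TopologicalSpace.PseudoMetrizableSpace X] (c : α → X) {N : α → Set X}
    (hN : ∀ a, N a ∈ 𝓝 (c a)) :
    ∃ V : α → Set X, (∀ a, IsOpen (V a)) ∧ (∀ a, c a ∈ V a) ∧
      ∀ x ∈ ⋃ a, V a, ∃ z, ∀ b, x ∈ V b → V b ⊆ N z := by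
  let := TopologicalSpace.pseudoMetrizableSpacePseudoMetric X
  have hball : ∀ a, ∃ r, 0 < r ∧ r ≤ 1 ∧ Metric.ball (c a) r ⊆ N a := by
    intro a
    obtain ⟨r, hr, hrN⟩ := Metric.mem_nhds_iff.1 (hN a)
    exact ⟨min r 1, by positivity, min_le_right _ _,
      (Metric.ball_subset_ball (min_le_left _ _)).trans hrN⟩
  choose r hr hr1 hrN using hball
  refine ⟨fun a => Metric.ball (c a) (r a / 5), fun a => Metric.isOpen_ball,
    fun a => Metric.mem_ball_self (by linarith [hr a]), fun x hx => ?_⟩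
  obtain ⟨a, ha⟩ := mem_iUnion.1 hx
  obtain ⟨z, hz⟩ := exists_ball_forall_ball_subset hr hr1 ha
  exact ⟨z, fun b hb => (hz b hb).trans (hrN z)⟩

theorem CoveringDimLE.mono {X : Type u} [TopologicalSpace X] {m n : ℕ} (h : CoveringDimLE X m)
    (hmn : m ≤ n) : CoveringDimLE X n := fun 𝒰 ho hc => by
  obtain ⟨𝒱, hVo, hVc, hVU, hcard⟩ := h 𝒰 ho hc
  exact ⟨𝒱, hVo, hVc, hVU, fun x => (hcard x).trans (by gcongr)⟩

theorem CoveringDimLE.exists_refinement {X : Type u} [TopologicalSpace X] {n : ℕ}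
    (hdim : CoveringDimLE X n) {N : X → Set X} (ho : ∀ x, IsOpen (N x)) (hmem : ∀ x, x ∈ N x) :
    ∃ (ι : Type u) (O : ι → Set X), (∀ v, IsOpen (O v)) ∧ (∀ v, (O v).Nonempty) ∧
      ⋃ v, O v = univ ∧ (∀ v, ∃ x, O v ⊆ N x) ∧
      ∀ B : Finset ι, (⋂ v ∈ B, O v).Nonempty → B.card ≤ n + 1 := by
  obtain ⟨𝒱, hVo, hVc, hVN, hcard⟩ := hdim (range N) (by rintro _ ⟨x, rfl⟩; exact ho x)
    (eq_univ_of_forall fun x => ⟨_, ⟨x, rfl⟩, hmem x⟩)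
  refine ⟨{B : Set X // B ∈ 𝒱 ∧ B.Nonempty}, Subtype.val, fun v => hVo v v.2.1, fun v => v.2.2,
    eq_univ_of_forall fun x => ?_, fun v => ?_, fun B ⟨x, hx⟩ => ?_⟩
  · obtain ⟨B, hB, hxB⟩ := mem_sUnion.1 (hVc ▸ mem_univ x)
    exact mem_iUnion.2 ⟨⟨B, hB, x, hxB⟩, hxB⟩
  · obtain ⟨_, ⟨x, rfl⟩, hx⟩ := hVN v v.2.1
    exact ⟨x, hx⟩
  · have hsub : ((B.map (Function.Embedding.subtype _) : Finset (Set X)) : Set (Set X)) ⊆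
        {C ∈ 𝒱 | x ∈ C} := by
      intro C hC
      obtain ⟨v, hv, rfl⟩ := Finset.mem_map.1 (Finset.mem_coe.1 hC)
      exact ⟨v.2.1, mem_iInter₂.1 hx v hv⟩
    have hle := (encard_le_encard hsub).trans (hcard x)
    rw [encard_coe_eq_coe_finsetCard, Finset.card_map] at hle
    exact_mod_cast hle

theorem CoveringDimLE.exists_barycentricRefinement {X : Type u} [TopologicalSpace X]
    [TopologicalSpace.PseudoMetrizableSpace X] {n : ℕ} (hdim : CoveringDimLE X n) {N : X → Set X}
    (hN : ∀ x, N x ∈ 𝓝 x) :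
    ∃ (ι : Type u) (O : ι → Set X), (∀ v, IsOpen (O v)) ∧ (∀ v, (O v).Nonempty) ∧
      ⋃ v, O v = univ ∧ IsBarycentricRefinement O N ∧
      ∀ B : Finset ι, (⋂ v ∈ B, O v).Nonempty → B.card ≤ n + 1 := by
  obtain ⟨V, hVo, hmemV, hVN⟩ := exists_isOpen_nhds_barycentric id hN
  obtain ⟨ι, O, hO, hne, hcover, hOV, hcard⟩ := hdim.exists_refinement hVo hmemV
  refine ⟨ι, O, hO, hne, hcover, fun x => ?_, hcard⟩
  obtain ⟨z, hz⟩ := hVN x (mem_iUnion.2 ⟨x, hmemV x⟩)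
  refine ⟨z, fun v hxv => ?_⟩
  obtain ⟨y, hy⟩ := hOV v
  exact hy.trans (hz y (hy hxv))

theorem exists_isOpen_graph_subset_of_upperSemicontinuous {E : Type*} [TopologicalSpace X]
    [NormalSpace X] [ParacompactSpace X] [TopologicalSpace E] {H : MultivaluedMap X E}
    (hH : ∀ U, IsOpen U → IsOpen {x | H x ⊆ U}) {N : X → Set X} {V : X → Set E}
    (hN : ∀ x, N x ∈ 𝓝 x) (hV : ∀ x, IsOpen (V x)) (hHV : ∀ x, H x ⊆ V x) :
    ∃ W : Set (X × E), IsOpen W ∧ H.graph ⊆ W ∧ ∃ M : X → Set X, (∀ x, M x ∈ 𝓝 x) ∧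
      ∀ x, ∃ a, M x ⊆ N a ∧ ∀ p ∈ W, p.1 ∈ M x → p.2 ∈ V a := by
  obtain ⟨f, hf⟩ := PartitionOfUnity.exists_isSubordinate isClosed_univ
    (fun x => interior (N x) ∩ {x' | H x' ⊆ V x})
    (fun x => isOpen_interior.inter (hH _ (hV x)))
    (fun x _ => mem_iUnion.2 ⟨x, mem_interior_iff_mem_nhds.2 (hN x), hHV x⟩)
  have hclosed : IsClosed (⋃ a, tsupport (f a) ×ˢ (V a)ᶜ) := by
    refine LocallyFinite.isClosed_iUnion (fun p => ?_)
      fun a => (isClosed_tsupport _).prod (hV a).isClosed_compl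
    obtain ⟨S, hS, hfin⟩ := f.locallyFinite_tsupport p.1
    refine ⟨Prod.fst ⁻¹' S, continuous_fst.continuousAt.preimage_mem_nhds hS, hfin.subset ?_⟩
    rintro a ⟨q, hq, hqS⟩
    exact ⟨q.1, hq.1, hqS⟩
  choose a ha using fun x => f.exists_pos (mem_univ x)
  refine ⟨_, hclosed.isOpen_compl, fun p hp hmem => ?_, fun x => Function.support (f (a x)),
    fun x => (isOpen_ne.preimage (f (a x)).continuous).mem_nhds (ha x).ne', fun x => ⟨a x,
      fun y hy => interior_subset (hf (a x) (subset_tsupport _ hy)).1, fun p hp hpx => ?_⟩⟩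
  · obtain ⟨b, hb, hpb⟩ := mem_iUnion.1 hmem
    exact hpb ((hf b hb).2 hp)
  · by_contra hpV
    exact hp (mem_iUnion.2 ⟨a x, subset_tsupport _ hpx, hpV⟩)

end Covers

/-- A compact filtration of infinite length all of whose multivalued maps take values in one space
`E` and whose transformations are restrictions of maps defined on the whole of `X × E`. -/
structure AmbientFiltration (X E : Type*) [TopologicalSpace X] [TopologicalSpace E] where
  map : ℕ → MultivaluedMap X E
  isCompactMap : ∀ i, (map i).IsCompactMap
  trans : ℕ → C(X × E, E)
  mapsTo : ∀ i x, MapsTo ((trans i).curry x) (map i x) (map (i + 1) x)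

/-- Approximate connectedness up to the index `n`, for ambient filtrations. -/
def AmbientFiltration.IsAspheric {X E : Type*} [TopologicalSpace X] [TopologicalSpace E]
    (𝓗 : AmbientFiltration X E) (n : ℕ) : Prop :=
  ∀ i < n, ∀ x, AsphericAlong i ((𝓗.trans i).curry x) (𝓗.map i x) (𝓗.map (i + 1) x)

section Nerve

variable {X E ι : Type*}

/-- A map defined on the `d`-skeleton of the nerve of `O`, realized in `ι → ℝ`, and lying in `W`:
for `x` in all the members of `O` that span a simplex, `W` contains `(x, g s)` for each point `s`
of this simplex. The values of `g` outside the `d`-skeleton are irrelevant. -/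
structure IsNerveMap [TopologicalSpace E] (O : ι → Set X) (d : ℕ) (W : Set (X × E))
    (g : (ι → ℝ) → E) : Prop where
  continuousOn : ∀ B : Finset ι, (⋂ v ∈ B, O v).Nonempty → B.card ≤ d + 1 →
    ContinuousOn g (closedSimplex B)
  mem : ∀ B : Finset ι, B.card ≤ d + 1 → ∀ s ∈ closedSimplex B, ∀ x ∈ ⋂ v ∈ B, O v, (x, g s) ∈ W

theorem exists_gluing_along_skeleton {Z : Type*} {i : ℕ} {P : Finset ι → Prop}
    {ψ : (ι → ℝ) → Z} (G : ∀ B, P B → B.card = i + 2 → (ι → ℝ) → Z)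
    (hG : ∀ B (hB : P B) (hc : B.card = i + 2), EqOn (G B hB hc) ψ (simplexBoundary B)) :
    ∃ g : (ι → ℝ) → Z, (∀ B, B.card ≤ i + 1 → EqOn g ψ (closedSimplex B)) ∧
      ∀ B (hB : P B) (hc : B.card = i + 2), EqOn g (G B hB hc) (closedSimplex B) := by
  classical
  let IsOpenCell (s : ι → ℝ) (B : Finset ι) : Prop :=
    (P B ∧ B.card = i + 2) ∧ s ∈ closedSimplex B ∧ ∀ v ∈ B, s v ≠ 0
  refine ⟨fun s => if h : ∃ B, IsOpenCell s B then
    G h.choose h.choose_spec.1.1 h.choose_spec.1.2 s else ψ s, fun B hc s hs => ?_,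
    fun B hB hc s hs => ?_⟩
  · have hnot : ¬ ∃ B', IsOpenCell s B' := by
      rintro ⟨B', ⟨-, hc'⟩, -, hB'⟩
      have := Finset.card_le_card (subset_of_mem_closedSimplex hs hB')
      omega
    simp only [dif_neg hnot]
  · have huniq : ∀ B', IsOpenCell s B' → B' = B := fun B' ⟨⟨_, hc'⟩, _, hB'⟩ =>
      Finset.eq_of_subset_of_card_le (subset_of_mem_closedSimplex hs hB') (hc.trans hc'.symm).le
    by_cases hbd : s ∈ simplexBoundary B
    · have hnot : ¬ ∃ B', IsOpenCell s B' := by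
        rintro ⟨B', hB'⟩
        obtain ⟨-, v, hv, hsv⟩ := hbd
        obtain rfl := huniq B' hB'
        exact hB'.2.2 v hv hsv
      simp only [dif_neg hnot, hG B hB hc hbd]
    · have hcell : ∃ B', IsOpenCell s B' :=
        ⟨B, ⟨hB, hc⟩, hs, fun v hv hsv => hbd ⟨hs, v, hv, hsv⟩⟩
      simp only [dif_pos hcell]
      have := huniq _ hcell.choose_spec
      congr! 3

variable [TopologicalSpace X] [AddCommGroup E] [Module ℝ E] [TopologicalSpace E]

theorem IsNerveMap.exists_zero [IsTopologicalAddGroup E] [ContinuousSMul ℝ E]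
    {H : MultivaluedMap X E} {W : Set (X × E)} (hW : IsOpen W)
    (hHW : H.graph ⊆ W) : ∃ N : X → Set X, (∀ x, N x ∈ 𝓝 x) ∧
      ∀ {ι : Type*} {O : ι → Set X}, (∀ v, (O v).Nonempty) → IsBarycentricRefinement O N →
        ∃ g, IsNerveMap O 0 W g := by
  choose q hq using H.nonempty_apply
  refine ⟨fun a => {x | (x, q a) ∈ W}, fun a => ?_, fun {ι O} hne hON => ?_⟩
  · exact (hW.preimage (by fun_prop : Continuous fun x => (x, q a))).mem_nhds (hHW (hq a))
  have hvertex : ∀ v, ∃ z, ∀ x ∈ O v, (x, z) ∈ W := by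
    intro v
    obtain ⟨x, hx⟩ := hne v
    obtain ⟨a, ha⟩ := hON x
    exact ⟨q a, ha v hx⟩
  choose z hz using hvertex
  refine ⟨fun s => ∑ᶠ v, s v • z v, fun B _ _ => ?_, fun B hB s hs x hx => ?_⟩
  · exact ContinuousOn.congr (f := fun s => ∑ v ∈ B, s v • z v) (by fun_prop) fun s hs =>
      finsum_smul_eq_of_mem_closedSimplex hs z
  · obtain ⟨v, rfl⟩ := Finset.card_eq_one.1
      (hB.antisymm (nonempty_of_mem_closedSimplex hs).card_pos)
    have hsv : s v = 1 := by simpa using hs.2.2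
    simp only [finsum_smul_eq_of_mem_closedSimplex hs z, Finset.sum_singleton, hsv, one_smul]
    exact hz v x (by simpa using hx)

/-- The image of `g` under `T` when the point `s` of the nerve is assigned, in place of one base
point, the base points `y v` of its vertices with the weights `s v`. -/
noncomputable def averagedImage (T : C(X × E, E)) (y : ι → X) (g : (ι → ℝ) → E) (s : ι → ℝ) : E :=
  ∑ᶠ v, s v • T (y v, g s)

theorem averagedImage_mem_convexHull (T : C(X × E, E)) {y : ι → X} (g : (ι → ℝ) → E)
    {B : Finset ι} {N : Set X} (hy : ∀ v ∈ B, y v ∈ N) {s : ι → ℝ} (hs : s ∈ closedSimplex B) :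
    averagedImage T y g s ∈ convexHull ℝ ((fun x => T (x, g s)) '' N) := by
  rw [averagedImage, finsum_smul_eq_of_mem_closedSimplex hs]
  exact (convex_convexHull ℝ _).sum_mem (fun v _ => hs.1 v) hs.2.2 fun v hv =>
    subset_convexHull ℝ _ ⟨y v, hy v hv, rfl⟩

variable [IsTopologicalAddGroup E] [ContinuousSMul ℝ E]

theorem continuousOn_averagedImage (T : C(X × E, E)) (y : ι → X) {g : (ι → ℝ) → E}
    {B : Finset ι} (hg : ContinuousOn g (closedSimplex B)) :
    ContinuousOn (averagedImage T y g) (closedSimplex B) := by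
  refine ContinuousOn.congr (f := fun s => ∑ v ∈ B, s v • T (y v, g s)) ?_ fun s hs =>
    finsum_smul_eq_of_mem_closedSimplex hs _
  exact continuousOn_finsetSum _ fun v _ => (continuous_apply v).continuousOn.smul
    (T.continuous.comp_continuousOn (continuousOn_const.prodMk hg))

theorem FillsSpheres.exists_filling {i : ℕ} {T : C(X × E, E)} {N : Set X} {V U : Set E}
    (h : FillsSpheres i T N V U) {B : Finset ι} (hB : B.card = i + 2) {y : ι → X}
    (hy : ∀ v ∈ B, y v ∈ N) {g : (ι → ℝ) → E}
    (hg : ∀ B' ⊂ B, ContinuousOn g (closedSimplex B')) (hgV : MapsTo g (simplexBoundary B) V) :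
    ∃ G : C(ι → ℝ, E), (∀ s, G s ∈ U) ∧ EqOn G (averagedImage T y g) (simplexBoundary B) := by
  have hgc := continuousOn_simplexBoundary hg
  have hψc := continuousOn_simplexBoundary fun B' hB' => continuousOn_averagedImage T y (hg B' hB')
  obtain ⟨G, hGU, hG⟩ := exists_extension_of_forall_nullhomotopicIn hB
    (f := ⟨_, hψc.domRestrict⟩) (U := U) fun σ =>
      h.nullhomotopicIn (.comp ⟨_, hgc.domRestrict⟩ σ) _ (fun t => hgV (σ t).2)
        fun t => averagedImage_mem_convexHull T g hy (σ t).2.1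
  exact ⟨G, hGU, fun s hs => hG ⟨s, hs⟩⟩

theorem IsNerveMap.succ {i : ℕ} {O : ι → Set X} {T : C(X × E, E)} {W W' : Set (X × E)}
    {g : (ι → ℝ) → E} (hg : IsNerveMap O i W' g) (hne : ∀ v, (O v).Nonempty)
    (hlocal : ∀ B : Finset ι, (⋂ v ∈ B, O v).Nonempty → ∃ N V U, N ×ˢ U ⊆ W ∧
      FillsSpheres i T N V U ∧ (∀ v ∈ B, O v ⊆ N) ∧ ∀ p ∈ W', p.1 ∈ N → p.2 ∈ V) :
    ∃ g', IsNerveMap O (i + 1) W g' := by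
  choose y hy using hne
  have hfill : ∀ B : Finset ι, (⋂ v ∈ B, O v).Nonempty → B.card = i + 2 → ∃ G : C(ι → ℝ, E),
      (∀ s, ∀ x ∈ ⋂ v ∈ B, O v, (x, G s) ∈ W) ∧
      EqOn G (averagedImage T y g) (simplexBoundary B) := by
    intro B ⟨x, hx⟩ hB
    have hxO : ∀ v ∈ B, x ∈ O v := mem_iInter₂.1 hx
    obtain ⟨v, hv⟩ : B.Nonempty := Finset.card_pos.1 (by omega)
    obtain ⟨N, V, U, hNU, hfills, hON, hWV⟩ := hlocal B ⟨x, hx⟩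
    have hface : ∀ B' ⊂ B, x ∈ (⋂ v ∈ B', O v) ∧ B'.card ≤ i + 1 := fun B' hB' =>
      ⟨mem_iInter₂.2 fun w hw => hxO w (hB'.subset hw), by
        have := Finset.card_lt_card hB'; omega⟩
    obtain ⟨G, hGU, hG⟩ := hfills.exists_filling hB (fun v hv => hON v hv (hy v))
      (fun B' hB' => hg.continuousOn B' ⟨x, (hface B' hB').1⟩ (hface B' hB').2) fun s hs => by
        obtain ⟨B', hB', hs'⟩ := exists_ssubset_of_mem_simplexBoundary hs
        exact hWV _ (hg.mem B' (hface B' hB').2 s hs' x (hface B' hB').1) (hON v hv (hxO v hv))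
    exact ⟨G, fun s x' hx' => hNU (mk_mem_prod (hON v hv (mem_iInter₂.1 hx' v hv)) (hGU s)), hG⟩
  choose G hGW hG using hfill
  obtain ⟨g', hg'low, hg'top⟩ :=
    exists_gluing_along_skeleton (fun B hB hc => (G B hB hc : (ι → ℝ) → E)) hG
  refine ⟨g', fun B hB hc => ?_, fun B hc s hs x hx => ?_⟩ <;>
    rcases (Nat.lt_or_eq_of_le hc).imp_left Nat.le_of_lt_succ with hle | heq
  · exact (continuousOn_averagedImage T y (hg.continuousOn B hB hle)).congr (hg'low B hle)
  · exact (G B hB heq).continuous.continuousOn.congr (hg'top B hB heq)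
  · obtain ⟨N, V, U, hNU, hfills, hON, hWV⟩ := hlocal B ⟨x, hx⟩
    obtain ⟨v, hv⟩ := nonempty_of_mem_closedSimplex hs
    have hxN : x ∈ N := hON v hv (mem_iInter₂.1 hx v hv)
    rw [hg'low B hle hs]
    exact hNU (mk_mem_prod hxN (hfills.convexHull_subset _ (hWV _ (hg.mem B hle s hs x hx) hxN)
      (averagedImage_mem_convexHull T g (fun w hw => hON w hw (hy w)) hs)))
  · rw [hg'top B ⟨x, hx⟩ heq hs]
    exact hGW B ⟨x, hx⟩ heq s x hx

theorem AsphericAlong.exists_graph_nhd [LocallyConvexSpace ℝ E] [NormalSpace X]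
    [ParacompactSpace X] {i : ℕ} {H H' : MultivaluedMap X E} (hH : H.IsCompactMap)
    (hH' : H'.IsCompactMap) {T : C(X × E, E)} (hT : ∀ x, MapsTo (T.curry x) (H x) (H' x))
    (hA : ∀ x, AsphericAlong i (T.curry x) (H x) (H' x)) {W : Set (X × E)} (hW : IsOpen W)
    (hHW : H'.graph ⊆ W) :
    ∃ W', IsOpen W' ∧ H.graph ⊆ W' ∧ ∃ M : X → Set X, (∀ x, M x ∈ 𝓝 x) ∧
      ∀ x, ∃ V U, M x ×ˢ U ⊆ W ∧ FillsSpheres i T (M x) V U ∧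
        ∀ p ∈ W', p.1 ∈ M x → p.2 ∈ V := by
  have hlocal : ∀ x, ∃ (N : Set X) (V U : Set E), N ∈ 𝓝 x ∧ IsOpen V ∧ H x ⊆ V ∧ N ×ˢ U ⊆ W ∧
      FillsSpheres i T N V U := by
    intro x
    obtain ⟨N₀, U, hN₀, hU, hxN₀, hHU, hNU⟩ := generalized_tube_lemma
      (isCompact_singleton (x := x)) (hH'.isCompact_apply x) hW
      (by rintro ⟨_, q⟩ ⟨rfl, hq⟩; exact hHW hq)
    obtain ⟨N, V, hN, hxN, hV, hHV, hfills⟩ := (hA x).exists_fillsSpheres (hH.isCompact_apply x)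
      (hH'.isCompact_apply x) (hT x) hU hHU
    exact ⟨N ∩ N₀, V, U, (hN.inter hN₀).mem_nhds ⟨hxN, hxN₀ rfl⟩, hV, hHV,
      (prod_mono_left inter_subset_right).trans hNU, hfills.anti inter_subset_left⟩
  choose N V U hN hV hHV hNU hfills using hlocal
  obtain ⟨W', hW', hHW', M, hM, hMN⟩ :=
    exists_isOpen_graph_subset_of_upperSemicontinuous hH.upperSemicontinuous hN hV hHV
  refine ⟨W', hW', hHW', M, hM, fun x => ?_⟩
  obtain ⟨a, ha, haV⟩ := hMN x
  exact ⟨V a, U a, (prod_mono_left ha).trans (hNU a), (hfills a).anti ha, haV⟩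

theorem AmbientFiltration.exists_isNerveMap [LocallyConvexSpace ℝ E] [NormalSpace X]
    [ParacompactSpace X] {𝓗 : AmbientFiltration X E} {n : ℕ} (hA : 𝓗.IsAspheric n)
    {W : Set (X × E)} (hW : IsOpen W) (hHW : (𝓗.map n).graph ⊆ W) :
    ∃ N : X → Set X, (∀ x, N x ∈ 𝓝 x) ∧
      ∀ {ι : Type u} {O : ι → Set X}, (∀ v, (O v).Nonempty) → IsBarycentricRefinement O N →
        ∃ g, IsNerveMap O n W g := by
  induction n generalizing W with
  | zero => exact IsNerveMap.exists_zero hW hHW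
  | succ i ih =>
    obtain ⟨W', hW', hHW', M, hM, hlocal⟩ := AsphericAlong.exists_graph_nhd (𝓗.isCompactMap i)
      (𝓗.isCompactMap (i + 1)) (𝓗.mapsTo i) (hA i i.lt_succ_self) hW hHW
    obtain ⟨N, hN, hnerve⟩ := ih (fun j hj => hA j (hj.trans i.lt_succ_self)) hW' hHW'
    refine ⟨fun x => M x ∩ N x, fun x => Filter.inter_mem (hM x) (hN x), fun hne hO => ?_⟩
    obtain ⟨g, hg⟩ := hnerve hne (hO.mono fun _ => inter_subset_right)
    refine hg.succ (T := 𝓗.trans i) hne fun B hB => ?_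
    obtain ⟨a, ha⟩ := hO.exists_subset hB
    obtain ⟨V, U, hMU, hfills, hWV⟩ := hlocal a
    exact ⟨M a, V, U, hMU, hfills, fun v hv => (ha v hv).trans inter_subset_left, hWV⟩

/-- The canonical map of `X` into the nerve of a cover to which the partition of unity `f` is
subordinate, given by the values of `f`. -/
def nerveMap (f : PartitionOfUnity ι X) (x : X) (v : ι) : ℝ := f v x

theorem nerveMap_mem_closedSimplex {f : PartitionOfUnity ι X} {x : X} {B : Finset ι}
    (hB : f.finsupport x ⊆ B) : nerveMap f x ∈ closedSimplex B := by
  refine ⟨fun v => f.nonneg v x, fun v hv => ?_, f.sum_finsupport' (mem_univ x) hB⟩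
  by_contra hne
  exact hv (hB ((f.mem_finsupport x).2 hne))

theorem continuous_comp_nerveMap {O : ι → Set X} {f : PartitionOfUnity ι X}
    (hf : f.IsSubordinate O) {Z : Type*} [TopologicalSpace Z] {g : (ι → ℝ) → Z}
    (hg : ∀ B : Finset ι, (⋂ v ∈ B, O v).Nonempty → ContinuousOn g (closedSimplex B)) :
    Continuous (g ∘ nerveMap f) := by
  refine continuous_iff_continuousAt.2 fun x => ?_
  have hx : x ∈ ⋂ v ∈ f.fintsupport x, O v :=
    mem_iInter₂.2 fun v hv => hf v ((f.mem_fintsupport_iff x v).1 hv)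
  have hmem : ∀ᶠ y in 𝓝 x, nerveMap f y ∈ closedSimplex (f.fintsupport x) :=
    (f.eventually_finsupport_subset x).mono fun y => nerveMap_mem_closedSimplex
  have hcont : Continuous (nerveMap f) := continuous_pi fun v => (f v).continuous
  exact ((hg _ ⟨x, hx⟩ _ hmem.self_of_nhds).tendsto).comp
    (tendsto_nhdsWithin_iff.2 ⟨hcont.continuousAt, hmem⟩)

theorem AmbientFiltration.exists_approximation {X : Type u} [TopologicalSpace X]
    [TopologicalSpace.MetrizableSpace X] [LocallyConvexSpace ℝ E] {𝓗 : AmbientFiltration X E}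
    {n : ℕ} (hdim : CoveringDimLE X n) (hA : 𝓗.IsAspheric n) {W : Set (X × E)} (hW : IsOpen W)
    (hHW : (𝓗.map n).graph ⊆ W) : ∃ g : C(X, E), ∀ x, (x, g x) ∈ W := by
  let := TopologicalSpace.metrizableSpaceMetric X
  obtain ⟨N, hN, hnerve⟩ := 𝓗.exists_isNerveMap hA hW hHW
  obtain ⟨ι, O, hO, hne, hcover, hON, hcard⟩ := hdim.exists_barycentricRefinement hN
  obtain ⟨g, hg⟩ := hnerve hne hON
  obtain ⟨f, hf⟩ := PartitionOfUnity.exists_isSubordinate isClosed_univ O hO hcover.ge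
  have hfO : ∀ x, x ∈ ⋂ v ∈ f.finsupport x, O v := fun x => mem_iInter₂.2 fun v hv =>
    hf v (subset_tsupport _ ((f.mem_finsupport x).1 hv))
  exact ⟨⟨g ∘ nerveMap f,
      continuous_comp_nerveMap hf fun B hB => hg.continuousOn B hB (hcard B hB)⟩,
    fun x => hg.mem _ (hcard _ ⟨x, hfO x⟩) _ (nerveMap_mem_closedSimplex subset_rfl) x (hfO x)⟩

end Nerve

section RealSequences

theorem exists_isEmbedding_realSequences (Y : Type*) [TopologicalSpace Y]
    [TopologicalSpace.MetrizableSpace Y] [TopologicalSpace.SeparableSpace Y] :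
    ∃ e : Y → ℕ → ℝ, IsEmbedding e := by
  let := TopologicalSpace.metrizableSpaceMetric Y
  obtain ⟨e, he⟩ := Metric.PiNatEmbed.exists_embedding_to_hilbert_cube (X := Y)
  exact ⟨_, (IsEmbedding.piMap fun _ => IsEmbedding.subtypeVal).comp he⟩

theorem isANR_ulift_realSequences : IsANR (ULift.{w} (ℕ → ℝ)) where
  metrizable := Homeomorph.ulift.isEmbedding.metrizableSpace
  separable :=
    have : SecondCountableTopology (ULift.{w} (ℕ → ℝ)) :=
      Homeomorph.ulift.isEmbedding.secondCountableTopology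
    inferInstance
  retract W _ _ _ e he := by
    let := TopologicalSpace.metrizableSpaceMetric W
    obtain ⟨r, hr⟩ := ContinuousMap.exists_extension' he
      (⟨ULift.down, continuous_uliftDown⟩ : C(ULift.{w} (ℕ → ℝ), ℕ → ℝ))
    exact ⟨univ, isOpen_univ, subset_univ _, ⟨fun p => ULift.up (r p), by fun_prop⟩,
      fun z _ => congrArg ULift.up (congrFun hr z)⟩

variable {K : Type u} {K' : Type v} [TopologicalSpace K] [TopologicalSpace K'] {φ : C(K, K')}
  {m : ℕ}

theorem ApproxAspheric.approxAsphericPair (h : ApproxAspheric m K) (φ : C(K, K')) :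
    ApproxAsphericPair m φ := by
  intro Z _ Z' _ hZ _ e e' he _ O hO ψ hψ U hU
  have hpre : Subtype.val '' (ψ ⁻¹' U) ∈ 𝓝ˢ (range e) := by
    refine mem_nhdsSet_iff_forall.2 ?_
    rintro _ ⟨k, rfl⟩
    have hOk : O ∈ 𝓝 (e k) := mem_nhdsSet_iff_forall.1 hO _ ⟨k, rfl⟩
    have hUk : U ∈ 𝓝 (ψ ⟨e k, mem_of_mem_nhds hOk⟩) :=
      mem_nhdsSet_iff_forall.1 hU _ (hψ k _ ▸ mem_range_self _)
    rw [← map_nhds_subtype_coe_eq_nhds (mem_of_mem_nhds hOk) hOk]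
    exact Filter.image_mem_map (ψ.continuous.continuousAt hUk)
  obtain ⟨V, hV, hVnull⟩ := h Z hZ e he _ hpre
  refine ⟨V ∩ O, Filter.inter_mem hV hO, inter_subset_right, fun f hf => ?_⟩
  obtain ⟨g, hg, hnull⟩ := hVnull ⟨fun s => f s, by fun_prop⟩ fun s => (hf s).1
  have hO' : ∀ z : (Subtype.val '' (ψ ⁻¹' U) : Set Z), z.1 ∈ O := by
    rintro ⟨_, p, -, rfl⟩
    exact p.2
  let ψU : C((Subtype.val '' (ψ ⁻¹' U) : Set Z), U) :=
    ⟨fun z => ⟨ψ ⟨z, hO' z⟩, by obtain ⟨_, p, hp, rfl⟩ := z; exact hp⟩, by fun_prop⟩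
  exact ⟨ψU.comp g, fun s => congrArg ψ (Subtype.ext (hg s)), hnull.comp_right ψU⟩

theorem ApproxAsphericPair.asphericAlong (h : ApproxAsphericPair m φ) {e : K → ℕ → ℝ}
    {e' : K' → ℕ → ℝ} (he : IsEmbedding e) (he' : IsEmbedding e') {τ : C(ℕ → ℝ, ℕ → ℝ)}
    (hτ : ∀ k, τ (e k) = e' (φ k)) : AsphericAlong m τ (range e) (range e') := by
  intro U hU hKU
  let down : C(ULift.{v} (ℕ → ℝ), ℕ → ℝ) := ⟨ULift.down, continuous_uliftDown⟩
  obtain ⟨V, hV, -, hnull⟩ := h (ULift.{u} (ℕ → ℝ)) (ULift.{v} (ℕ → ℝ)) isANR_ulift_realSequences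
    isANR_ulift_realSequences (ULift.up ∘ e) (ULift.up ∘ e')
    (Homeomorph.ulift.symm.isEmbedding.comp he) (Homeomorph.ulift.symm.isEmbedding.comp he') univ
    Filter.univ_mem ⟨fun p => ULift.up (τ p.1.down), by fun_prop⟩
    (fun k _ => congrArg ULift.up (hτ k)) (down ⁻¹' U)
    ((hU.preimage down.continuous).mem_nhdsSet.2 (by rintro _ ⟨k, rfl⟩; exact hKU ⟨k, rfl⟩))
  obtain ⟨V', hV', hKV', hV'V⟩ := mem_nhdsSet_iff_exists.1 hV
  refine ⟨ULift.up ⁻¹' V', hV'.preimage continuous_uliftUp, ?_, fun f hf => ?_⟩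
  · rintro _ ⟨k, rfl⟩
    exact hKV' ⟨k, rfl⟩
  have hlift : NullhomotopicIn ⟨fun s => ULift.up (τ (f s)), by fun_prop⟩ (down ⁻¹' U) :=
    hnull ⟨fun s => ⟨ULift.up (f s), mem_univ _⟩, by fun_prop⟩ fun s => hV'V (hf s)
  exact hlift.comp_right down (mapsTo_preimage down U)

end RealSequences

section Filtrations

variable {X : Type*} {Y : Type*} [TopologicalSpace X] [TopologicalSpace Y]

/-- The multivalued map whose values are the images under `e` of the values of `F`. -/
def MultivaluedMap.image {E : Type*} (F : MultivaluedMap X Y) (e : Y → E) :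
    MultivaluedMap X E where
  toFun x := e '' F x
  nonempty_apply x := (F.nonempty_apply x).image e

namespace MultivaluedMap.IsCompactMap

variable {E : Type*} [TopologicalSpace E] {F : MultivaluedMap X Y}

theorem image (hF : F.IsCompactMap) {e : Y → E} (he : Continuous e) :
    (F.image e).IsCompactMap where
  upperSemicontinuous U hU := by
    simpa only [MultivaluedMap.image, image_subset_iff] using
      hF.upperSemicontinuous _ (hU.preimage he)
  isCompact_apply x := (hF.isCompact_apply x).image he

theorem isClosed_graph [T2Space Y] (hF : F.IsCompactMap) : IsClosed F.graph := by
  rw [← isOpen_compl_iff, isOpen_iff_mem_nhds]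
  rintro ⟨x, q⟩ hq
  obtain ⟨U, V, hU, hV, hxU, hqV, hUV⟩ := SeparatedNhds.of_isCompact_isCompact
    (hF.isCompact_apply x) isCompact_singleton (disjoint_singleton_right.2 hq)
  filter_upwards [prod_mem_nhds ((hF.upperSemicontinuous U hU).mem_nhds hxU)
    (hV.mem_nhds (hqV rfl))] with p ⟨hpU, hpV⟩ hp
  exact disjoint_left.1 hUV (hpU hp) hpV

theorem isClosedEmbedding_graph [T2Space E] (hF : F.IsCompactMap) {e : Y → E}
    (he : IsEmbedding e) :
    IsClosedEmbedding fun p : F.graph => ((p : X × Y).1, e (p : X × Y).2) := by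
  refine ⟨(IsEmbedding.id.prodMap he).comp IsEmbedding.subtypeVal, ?_⟩
  convert (hF.image he.continuous).isClosed_graph
  ext ⟨x, q⟩
  constructor
  · rintro ⟨⟨⟨x, y⟩, hy⟩, h⟩
    obtain ⟨rfl, rfl⟩ := Prod.mk.inj h
    exact mem_image_of_mem e hy
  · rintro ⟨y, hy, rfl⟩
    exact ⟨⟨(x, y), hy⟩, rfl⟩

theorem isProperMap_fst (hF : F.IsCompactMap) :
    IsProperMap fun p : F.graph => (p : X × Y).1 := by
  refine isProperMap_iff_isClosedMap_and_compact_fibers.2 ⟨by fun_prop, ?_, fun x => ?_⟩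
  · refine isClosedMap_iff_kernImage.2 fun {S} hS => ?_
    obtain ⟨W, hW, rfl⟩ := isOpen_induced_iff.1 hS
    refine isOpen_iff_mem_nhds.2 fun x hx => ?_
    obtain ⟨N, V, hN, hV, hxN, hFV, hNV⟩ := generalized_tube_lemma (isCompact_singleton (x := x))
      (hF.isCompact_apply x) hW (by rintro ⟨_, y⟩ ⟨rfl, hy⟩; exact hx (x := ⟨(_, y), hy⟩) rfl)
    filter_upwards [hN.mem_nhds (hxN rfl), (hF.upperSemicontinuous V hV).mem_nhds hFV]
    rintro _ hxN hxV p rfl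
    exact hNV (mk_mem_prod hxN (hxV p.2))
  · have := isCompact_iff_compactSpace.1 (hF.isCompact_apply x)
    convert isCompact_range (f := fun y : F x => (⟨(x, y), y.2⟩ : F.graph)) (by fun_prop)
    ext ⟨⟨x', y⟩, hy⟩
    constructor
    · rintro rfl
      exact ⟨⟨y, hy⟩, rfl⟩
    · rintro ⟨_, h⟩
      exact congrArg (fun p : F.graph => (p : X × Y).1) h.symm

end MultivaluedMap.IsCompactMap

/-- The identity transformation, by which a filtration is prolonged. -/
def FiberwiseTransformation.refl (F : MultivaluedMap X Y) : FiberwiseTransformation F F where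
  toMap := ContinuousMap.id _
  fst_eq _ := rfl

theorem FiberwiseTransformation.exists_ambient_extension {X : Type u} {E : Type v}
    {Y' Z : Type*} [TopologicalSpace X] [TopologicalSpace E] [T2Space E] [NormalSpace (X × E)]
    [TopologicalSpace Y'] [TopologicalSpace Z] [TietzeExtension.{max u v} Z]
    {F : MultivaluedMap X Y} {G : MultivaluedMap X Y'}
    (T : FiberwiseTransformation F G) (hF : F.IsCompactMap) {e : Y → E} (he : IsEmbedding e)
    {e' : Y' → Z} (he' : Continuous e') :
    ∃ τ : C(X × E, Z), ∀ x (y : F x), τ.curry x (e y) = e' (T.fiber x y) := by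
  obtain ⟨τ, hτ⟩ := ContinuousMap.exists_extension' (hF.isClosedEmbedding_graph he)
    (⟨fun p => e' (T.toMap p : X × Y').2, by fun_prop⟩ : C(F.graph, Z))
  exact ⟨τ, fun x y => congrFun hτ ⟨(x, y), y.2⟩⟩

end Filtrations

namespace SingularFiltration

variable {X : Type u} {Y : Type v} [TopologicalSpace X] [TopologicalSpace Y]
  {F : MultivaluedMap X Y} {n m : ℕ} {ℱ : SingularFiltration.{u, v, w} F n}

theorem exists_approxAsphericPair (hA : ℱ.IsApproxConnected)
    (hlast : ∀ x k, n ≤ k → k < m → ApproxAspheric k (ℱ.map (Fin.last n) x)) (i : ℕ) :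
    ∃ T : FiberwiseTransformation (ℱ.map (Fin.clamp i n)) (ℱ.map (Fin.clamp (i + 1) n)),
      i < m → ∀ x, ApproxAsphericPair i (T.fiber x) := by
  rcases Nat.lt_or_ge i n with hi | hi
  · have hi0 : Fin.clamp i n = Fin.castSucc ⟨i, hi⟩ := Fin.ext (min_eq_left hi.le)
    have hi1 : Fin.clamp (i + 1) n = Fin.succ ⟨i, hi⟩ := Fin.ext (min_eq_left hi)
    rw [hi0, hi1]
    exact ⟨ℱ.trans ⟨i, hi⟩, fun _ x => hA x ⟨i, hi⟩⟩
  · rw [Fin.clamp_eq_last i n hi, Fin.clamp_eq_last (i + 1) n (hi.trans i.le_succ)]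
    exact ⟨.refl _, fun him x => (hlast x i hi him).approxAsphericPair _⟩

theorem exists_ambientFiltration [TopologicalSpace.MetrizableSpace X] (hnm : n ≤ m)
    (hc : ℱ.IsCompactFiltration) (hA : ℱ.IsApproxConnected)
    (hlast : ∀ x k, n ≤ k → k < m → ApproxAspheric k (ℱ.map (Fin.last n) x)) :
    ∃ (e : ℱ.space (Fin.last n) → ℕ → ℝ) (𝓗 : AmbientFiltration X (ℕ → ℝ)),
      IsEmbedding e ∧ 𝓗.map m = (ℱ.map (Fin.last n)).image e ∧ 𝓗.IsAspheric m := by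
  have := ℱ.metrizable
  have := ℱ.separable
  let := TopologicalSpace.metrizableSpaceMetric X
  choose e he using fun i => exists_isEmbedding_realSequences (ℱ.space i)
  choose T hT using ℱ.exists_approxAsphericPair hA hlast
  choose τ hτ using fun i => (T i).exists_ambient_extension (hc _) (he _) (he _).continuous
  have hemb : ∀ i x, IsEmbedding fun y : ℱ.map i x => e i y := fun i x =>
    (he i).comp IsEmbedding.subtypeVal
  let 𝓗 : AmbientFiltration X (ℕ → ℝ) :=
    { map := fun i => (ℱ.map (Fin.clamp i n)).image (e _)
      isCompactMap := fun i => (hc _).image (he _).continuous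
      trans := τ
      mapsTo := by
        rintro i x _ ⟨y, hy, rfl⟩
        exact ⟨_, ((T i).fiber x ⟨y, hy⟩).2, (hτ i x ⟨y, hy⟩).symm⟩ }
  refine ⟨e _, 𝓗, he _, ?_, fun i hi x => ?_⟩
  · change (ℱ.map (Fin.clamp m n)).image (e _) = _
    rw [Fin.clamp_eq_last m n hnm]
  · simp only [𝓗, MultivaluedMap.image, image_eq_range]
    exact (hT i hi x).asphericAlong (hemb _ x) (hemb _ x) (hτ i x)

end SingularFiltration

section Extensors

/-- Up to an arbitrarily small error, measured by a neighborhood of the graph, maps to `Y` extend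
from closed subsets of metrizable spaces to neighborhoods. This is the property of the target that
the approximation theorem uses: convexity of `Y` yields it with an error, an ANR without. -/
def ApproxNeighborhoodExtensor (Y : Type v) [TopologicalSpace Y] : Prop :=
  ∀ (M : Type u) [TopologicalSpace M] [TopologicalSpace.MetrizableSpace M] (A : Set M),
    IsClosed A → ∀ f : C(A, Y), ∀ 𝒢 : Set (M × Y), IsOpen 𝒢 → (∀ a : A, ((a : M), f a) ∈ 𝒢) →
      ∃ W, IsOpen W ∧ A ⊆ W ∧ ∃ F : C(W, Y), ∀ m : W, ((m : M), F m) ∈ 𝒢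

theorem ApproxNeighborhoodExtensor.exists_extension {Y : Type v} [TopologicalSpace Y]
    (hY : ApproxNeighborhoodExtensor.{u} Y) {A : Type*} {M : Type u} [TopologicalSpace A]
    [TopologicalSpace M] [TopologicalSpace.MetrizableSpace M] {ε : A → M}
    (hε : IsClosedEmbedding ε) (f : C(A, Y)) {𝒢 : Set (M × Y)} (h𝒢 : IsOpen 𝒢)
    (hf : ∀ a, (ε a, f a) ∈ 𝒢) :
    ∃ W, IsOpen W ∧ range ε ⊆ W ∧ ∃ F : C(W, Y), ∀ m : W, ((m : M), F m) ∈ 𝒢 := by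
  let ε' := hε.isEmbedding.toHomeomorph
  refine hY M (range ε) hε.isClosed_range (f.comp ⟨ε'.symm, ε'.symm.continuous⟩) 𝒢 h𝒢 fun m => ?_
  obtain ⟨a, rfl⟩ := ε'.surjective m
  change (ε a, f (ε'.symm (ε' a))) ∈ 𝒢
  rw [ε'.symm_apply_apply]
  exact hf a

theorem approxNeighborhoodExtensor_of_locallyConvexSpace (Y : Type v) [AddCommGroup Y] [Module ℝ Y]
    [TopologicalSpace Y] [IsTopologicalAddGroup Y] [ContinuousSMul ℝ Y]
    [LocallyConvexSpace ℝ Y] : ApproxNeighborhoodExtensor.{u} Y := by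
  intro M _ _ A _ f 𝒢 h𝒢 hf
  have hlocal : ∀ a : A, ∃ N ∈ 𝓝 (a : M), ∃ C : Set Y, Convex ℝ C ∧ N ×ˢ C ⊆ 𝒢 ∧
      ∀ a' : A, (a' : M) ∈ N → f a' ∈ C := by
    intro a
    obtain ⟨N, hN, S, hS, hNS⟩ := mem_nhds_prod_iff.1 (h𝒢.mem_nhds (hf a))
    obtain ⟨C, ⟨hC, hCconv⟩, hCS⟩ := (LocallyConvexSpace.convex_basis (𝕜 := ℝ) (f a)).mem_iff.1 hS
    obtain ⟨N', hN', hN'C⟩ := mem_nhds_induced _ _ _ |>.1 (f.continuous.continuousAt hC)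
    exact ⟨N ∩ N', Filter.inter_mem hN hN', C, hCconv,
      (prod_mono inter_subset_left hCS).trans hNS, fun a' ha' => hN'C ha'.2⟩
  choose N hN C hC hNC hfC using hlocal
  obtain ⟨V, hV, hmemV, hVN⟩ := exists_isOpen_nhds_barycentric (Subtype.val : A → M) hN
  let := TopologicalSpace.metrizableSpaceMetric M
  obtain ⟨F, hF⟩ := exists_continuous_forall_mem_convex_of_local_const
    (t := fun m : (⋃ a, V a : Set M) => convexHull ℝ (f '' {a | (m : M) ∈ V a}))
    (fun m => convex_convexHull ℝ _) fun m => by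
      obtain ⟨a, ha⟩ := mem_iUnion.1 m.2
      exact ⟨f a, Filter.mem_of_superset (((hV a).preimage continuous_subtype_val).mem_nhds ha)
        fun m' hm' => subset_convexHull ℝ _ ⟨a, hm', rfl⟩⟩
  refine ⟨⋃ a, V a, isOpen_iUnion hV, fun a ha => mem_iUnion.2 ⟨⟨a, ha⟩, hmemV _⟩, F, fun m => ?_⟩
  obtain ⟨a, ha⟩ := mem_iUnion.1 m.2
  obtain ⟨z, hz⟩ := hVN m m.2
  refine hNC z (mk_mem_prod (hz a ha ha) (convexHull_min ?_ (hC z) (hF m)))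
  rintro _ ⟨b, hb, rfl⟩
  exact hfC z b (hz b hb (hmemV b))

theorem exists_continuous_eq_zero_iff_mem {M : Type*} [TopologicalSpace M]
    [TopologicalSpace.PseudoMetrizableSpace M] {A : Set M} (hA : IsClosed A) :
    ∃ d : C(M, ℝ), ∀ m, d m = 0 ↔ m ∈ A := by
  let := TopologicalSpace.pseudoMetrizableSpacePseudoMetric M
  rcases A.eq_empty_or_nonempty with rfl | hne
  · exact ⟨1, by simp⟩
  · exact ⟨⟨_, Metric.continuous_infDist_pt A⟩, fun m => (hA.mem_iff_infDist_zero hne).symm⟩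

/-- The space `ℝ^ω × ℝ` with the points of the slice `ℝ^ω × {0}` outside `S` removed. The set `S`,
closed or not, is a closed subset of it. -/
def sliceOver (S : Set (ℕ → ℝ)) : Set ((ℕ → ℝ) × ℝ) := {p | p.2 = 0 → p.1 ∈ S}

theorem isClosedEmbedding_sliceOver {Y : Type*} [TopologicalSpace Y] {e : Y → ℕ → ℝ}
    (he : IsEmbedding e) :
    IsClosedEmbedding fun y => (⟨(e y, 0), fun _ => mem_range_self y⟩ : sliceOver (range e)) := by
  have := he.continuous
  refine ⟨.of_comp (f := fun y => (⟨(e y, 0), fun _ => mem_range_self y⟩ : sliceOver (range e)))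
    (g := fun p => p.1.1) (by fun_prop) (by fun_prop) he, ?_⟩
  convert isClosed_eq (f := fun p : sliceOver (range e) => p.1.2) (by fun_prop)
    (continuous_const (y := 0))
  ext ⟨⟨q, t⟩, hp⟩
  constructor
  · rintro ⟨y, hy⟩
    exact congrArg (fun p => p.1.2) hy.symm
  · rintro rfl
    obtain ⟨y, rfl⟩ := hp rfl
    exact mem_range_self y

theorem IsANR.exists_retraction_sliceOver {Y : Type v} [TopologicalSpace Y] (hY : IsANR Y)
    {e : Y → ℕ → ℝ} (he : IsEmbedding e) :
    ∃ O : Set (sliceOver (range e)), IsOpen O ∧ ∃ r : C(O, Y), ∀ y,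
      ∃ h : (⟨(e y, 0), fun _ => mem_range_self y⟩ : sliceOver (range e)) ∈ O, r ⟨_, h⟩ = y := by
  have hdown : IsEmbedding (ULift.down : ULift.{v} (sliceOver (range e)) → _) :=
    Homeomorph.ulift.isEmbedding
  have := hdown.metrizableSpace
  have := hdown.secondCountableTopology
  obtain ⟨O, hO, hYO, r, hr⟩ := hY.retract (ULift.{v} (sliceOver (range e)))
    (ULift.up ∘ _) (Homeomorph.ulift.symm.isClosedEmbedding.comp (isClosedEmbedding_sliceOver he))
  exact ⟨ULift.up ⁻¹' O, hO.preimage continuous_uliftUp, ⟨fun p => r ⟨ULift.up p.1, p.2⟩,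
    by fun_prop⟩, fun y => ⟨hYO (mem_range_self y), hr y _⟩⟩

theorem IsANR.exists_extension {Y : Type v} [TopologicalSpace Y] (hY : IsANR Y)
    {M : Type*} [TopologicalSpace M] [TopologicalSpace.MetrizableSpace M]
    {A : Set M} (hA : IsClosed A) (f : C(A, Y)) :
    ∃ W, IsOpen W ∧ ∃ F : C(W, Y), ∀ a : A, ∃ ha : (a : M) ∈ W, F ⟨a, ha⟩ = f a := by
  have := hY.metrizable
  have := hY.separable
  let := TopologicalSpace.metrizableSpaceMetric M
  obtain ⟨e, he⟩ := exists_isEmbedding_realSequences Y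
  obtain ⟨d, hd⟩ := exists_continuous_eq_zero_iff_mem hA
  obtain ⟨g, hg⟩ := ContinuousMap.exists_restrict_eq hA ((⟨e, he.continuous⟩ : C(Y, ℕ → ℝ)).comp f)
  have hge : ∀ a : A, g a = e (f a) := fun a => DFunLike.congr_fun hg a
  obtain ⟨O, hO, r, hr⟩ := hY.exists_retraction_sliceOver he
  let Θ : C(M, sliceOver (range e)) := ⟨fun m => ⟨(g m, d m), fun h =>
    ⟨f ⟨m, (hd m).1 h⟩, (hge ⟨m, (hd m).1 h⟩).symm⟩⟩, by fun_prop⟩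
  have hΘ : ∀ a : A, Θ a = ⟨(e (f a), 0), fun _ => mem_range_self _⟩ := fun a =>
    Subtype.ext (Prod.ext (hge a) ((hd a).2 a.2))
  refine ⟨Θ ⁻¹' O, hO.preimage Θ.continuous, ⟨fun m => r ⟨Θ m, m.2⟩, by fun_prop⟩, fun a => ?_⟩
  obtain ⟨hmem, hra⟩ := hr (f a)
  rw [← hΘ] at hmem
  exact ⟨hmem, by simpa only [ContinuousMap.coe_mk, hΘ] using hra⟩

theorem IsANR.approxNeighborhoodExtensor {Y : Type v} [TopologicalSpace Y] (hY : IsANR Y) :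
    ApproxNeighborhoodExtensor.{u} Y := by
  intro M _ _ A hA f 𝒢 h𝒢 hf
  obtain ⟨W, hW, F, hF⟩ := hY.exists_extension hA f
  refine ⟨Subtype.val '' {m : W | ((m : M), F m) ∈ 𝒢},
    hW.isOpenMap_subtype_val _ (h𝒢.preimage (by fun_prop)), fun a ha => ?_, ?_⟩
  · obtain ⟨haW, hFa⟩ := hF ⟨a, ha⟩
    exact ⟨⟨a, haW⟩, by simpa only [mem_ofPred_eq, hFa] using hf ⟨a, ha⟩, rfl⟩
  · have hmem : ∀ m : (Subtype.val '' {m : W | ((m : M), F m) ∈ 𝒢} : Set M),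
        ∃ h : (m : M) ∈ W, ((m : M), F ⟨m, h⟩) ∈ 𝒢 := by
      rintro ⟨_, m, hm, rfl⟩
      exact ⟨m.2, hm⟩
    choose h h𝒢F using hmem
    exact ⟨⟨fun m => F ⟨m, h m⟩, by fun_prop⟩, h𝒢F⟩

end Extensors

theorem SingularFiltration.exists_approximation {X : Type u} [TopologicalSpace X]
    [TopologicalSpace.MetrizableSpace X] {Y : Type v} [TopologicalSpace Y]
    (hY : ApproxNeighborhoodExtensor.{u} Y) {F : MultivaluedMap X Y} {n m : ℕ}
    (ℱ : SingularFiltration.{u, v, w} F n) (hnm : n ≤ m) (hdim : CoveringDimLE X m)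
    (hc : ℱ.IsCompactFiltration) (hA : ℱ.IsApproxConnected)
    (hlast : ∀ x k, n ≤ k → k < m → ApproxAspheric k (ℱ.map (Fin.last n) x))
    {U : Set (X × Y)} (hU : IsOpen U) (hFU : ∀ p, (ℱ.transLast.toMap p : X × Y) ∈ U) :
    ∃ f : C(X, Y), ∀ x, (x, f x) ∈ U := by
  obtain ⟨e, 𝓗, he, hmap, hA𝓗⟩ := ℱ.exists_ambientFiltration hnm hc hA hlast
  obtain ⟨W, hW, hFW, Φ, hΦ⟩ := hY.exists_extension ((hc _).isClosedEmbedding_graph he)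
    ⟨fun p => (ℱ.transLast.toMap p : X × Y).2, by fun_prop⟩
    (hU.preimage (f := fun p : (X × (ℕ → ℝ)) × Y => (p.1.1, p.2)) (by fun_prop))
    fun p => by simpa [← ℱ.transLast.fst_eq p] using hFU p
  obtain ⟨g, hg⟩ := 𝓗.exists_approximation hdim hA𝓗 hW <| by
    rw [hmap]
    rintro ⟨x, _⟩ ⟨y, hy, rfl⟩
    exact hFW ⟨⟨(x, y), hy⟩, rfl⟩
  exact ⟨⟨fun x => Φ ⟨(x, g x), hg x⟩, by fun_prop⟩, fun x => hΦ ⟨(x, g x), hg x⟩⟩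

section Grids

variable {ι : Type*} [Fintype ι] {η : ℝ}

theorem dist_mul_floor_div_lt (hη : 0 < η) (t : ℝ) : dist t (η * ⌊t / η⌋) < η := by
  have hfract : t - η * ⌊t / η⌋ = η * Int.fract (t / η) := by
    rw [Int.fract, mul_sub, mul_div_cancel₀ t hη.ne']
  rw [Real.dist_eq, hfract, abs_of_nonneg (mul_nonneg hη.le (Int.fract_nonneg _))]
  exact mul_lt_of_lt_one_right hη (Int.fract_lt_one _)

theorem eq_floor_or_eq_floor_add_one_of_dist_lt {t : ℝ} {k : ℤ} (h : dist t (η * k) < η) :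
    k = ⌊t / η⌋ ∨ k = ⌊t / η⌋ + 1 := by
  have hη : 0 < η := dist_nonneg.trans_lt h
  obtain ⟨hlow, hup⟩ := abs_lt.1 h
  have hlt : ⌊t / η⌋ < k + 1 := Int.floor_lt.2 <| by
    push_cast
    rw [div_lt_iff₀ hη]
    linarith
  have hle : k - 1 ≤ ⌊t / η⌋ := Int.le_floor.2 <| by
    push_cast
    rw [le_div_iff₀ hη]
    linarith
  omega

/-- The open cube of side `2 * η`, a ball for the sup norm, about a point of the lattice
`η ℤ^ι`. Neighboring cubes overlap, so that they cover the space. -/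
def gridCube (η : ℝ) (k : ι → ℤ) : Set (ι → ℝ) := Metric.ball (fun i => η * k i) η

theorem exists_mem_gridCube (hη : 0 < η) (x : ι → ℝ) : ∃ k, x ∈ gridCube η k :=
  ⟨fun i => ⌊x i / η⌋, (dist_pi_lt_iff hη).2 fun i => dist_mul_floor_div_lt hη (x i)⟩

theorem encard_setOf_mem_gridCube_le (x : ι → ℝ) :
    {k | x ∈ gridCube η k}.encard ≤ 2 ^ Fintype.card ι := by
  classical
  let I : Finset (ι → ℤ) := Fintype.piFinset fun i => {⌊x i / η⌋, ⌊x i / η⌋ + 1}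
  have hI : I.card ≤ 2 ^ Fintype.card ι := by
    rw [Fintype.card_piFinset]
    exact Finset.prod_le_pow_card _ _ _ fun i _ => Finset.card_le_two
  refine (encard_le_encard (t := I) fun k hk => Fintype.mem_piFinset.2 fun i => ?_).trans ?_
  · simpa using eq_floor_or_eq_floor_add_one_of_dist_lt ((dist_le_pi_dist _ _ i).trans_lt hk)
  · rw [encard_coe_eq_coe_finsetCard]
    exact_mod_cast hI

theorem coveringDimLE_of_isCompact {P : Set (ι → ℝ)} (hP : IsCompact P) :
    CoveringDimLE P (2 ^ Fintype.card ι) := by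
  intro 𝒰 ho hc
  have : CompactSpace P := isCompact_iff_compactSpace.1 hP
  obtain ⟨δ, hδ, hδ𝒰⟩ := lebesgue_number_lemma_of_metric_sUnion (s := (univ : Set P))
    isCompact_univ ho hc.ge
  let C : (ι → ℤ) → Set P := fun k => Subtype.val ⁻¹' gridCube (δ / 2) k
  refine ⟨{B ∈ range C | B.Nonempty}, ?_, eq_univ_of_forall fun x => ?_, ?_, fun x => ?_⟩
  · rintro _ ⟨⟨k, rfl⟩, -⟩
    exact Metric.isOpen_ball.preimage continuous_subtype_val
  · obtain ⟨k, hk⟩ := exists_mem_gridCube (half_pos hδ) (x : ι → ℝ)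
    exact ⟨C k, ⟨⟨k, rfl⟩, x, hk⟩, hk⟩
  · rintro _ ⟨⟨k, rfl⟩, x, hx⟩
    obtain ⟨A, hA, hxA⟩ := hδ𝒰 x (mem_univ x)
    exact ⟨A, hA, fun y hy => hxA ((dist_triangle_right y.1 x.1 _).trans_lt
      ((add_lt_add (Metric.mem_ball.1 hy) (Metric.mem_ball.1 hx)).trans_eq (add_halves δ)))⟩
  · calc {B ∈ {B ∈ range C | B.Nonempty} | x ∈ B}.encard
        ≤ (C '' {k | (x : ι → ℝ) ∈ gridCube (δ / 2) k}).encard := by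
          refine encard_le_encard ?_
          rintro _ ⟨⟨⟨k, rfl⟩, -⟩, hx⟩
          exact mem_image_of_mem C hx
      _ ≤ 2 ^ Fintype.card ι := (encard_image_le _ _).trans (encard_setOf_mem_gridCube_le _)
      _ ≤ _ := by exact_mod_cast Nat.le_succ _

end Grids

section Factorization

theorem isOpen_setOf_forall_fiber_mem {A B C : Type*} [TopologicalSpace A] [TopologicalSpace B]
    [TopologicalSpace C] {f : A → B} (hf : IsProperMap f) {S : Set (C × A)} (hS : IsOpen S) :
    IsOpen {z : C × B | ∀ a, f a = z.2 → (z.1, a) ∈ S} := by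
  convert isClosedMap_iff_kernImage.1 (isProperMap_id.prodMap hf).isClosedMap hS using 1
  ext ⟨c, b⟩
  constructor
  · rintro h ⟨_, a⟩ ⟨⟩
    exact h a rfl
  · rintro h a rfl
    exact h (x := (c, a)) rfl

theorem exists_finset_forall_eqOn_imp_mem {K ι : Type*} {E : ι → Type*} [TopologicalSpace K]
    [CompactSpace K] [∀ i, TopologicalSpace (E i)] {e : K → ∀ i, E i} (he : Continuous e)
    {D : Set (K × ∀ i, E i)} (hD : IsOpen D) (heD : ∀ k, (k, e k) ∈ D) :
    ∃ I : Finset ι, ∀ k q, (∀ i ∈ I, q i = e k i) → (k, q) ∈ D := by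
  classical
  suffices ∃ I : Finset ι, ∀ k ∈ (univ : Set K), ∀ q, (∀ i ∈ I, q i = e k i) → (k, q) ∈ D by
    simpa only [mem_univ, true_imp_iff] using this
  refine isCompact_univ.induction_on (p := fun s => ∃ I : Finset ι, ∀ k ∈ s, ∀ q,
    (∀ i ∈ I, q i = e k i) → (k, q) ∈ D) ⟨∅, by simp⟩ ?_ ?_ fun k _ => ?_
  · rintro s t hst ⟨I, hI⟩
    exact ⟨I, fun k hk => hI k (hst hk)⟩
  · rintro s t ⟨I, hI⟩ ⟨J, hJ⟩
    exact ⟨I ∪ J, fun k hk q hq => hk.elim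
      (fun hk => hI k hk q fun i hi => hq i (Finset.mem_union_left J hi))
      (fun hk => hJ k hk q fun i hi => hq i (Finset.mem_union_right I hi))⟩
  · obtain ⟨N, S, hN, hS, hkN, hkS, hNS⟩ := isOpen_prod_iff.1 hD _ _ (heD k)
    obtain ⟨I, u, hu, huS⟩ := isOpen_pi_iff.1 hS _ hkS
    refine ⟨N ∩ e ⁻¹' (I : Set ι).pi u, mem_nhdsWithin_of_mem_nhds <|
      ((hN.inter ((isOpen_set_pi I.finite_toSet fun i hi => (hu i hi).1).preimage he)).mem_nhds
        ⟨hkN, fun i hi => (hu i hi).2⟩), I, fun k' hk' q hq => ?_⟩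
    exact hNS (mk_mem_prod hk'.1 (huS fun i hi => hq i hi ▸ hk'.2 i hi))

theorem IsANR.exists_factorization_near {X : Type u} [TopologicalSpace X] (hX : IsANR X)
    {K : Type*} [TopologicalSpace K] [CompactSpace K] [TopologicalSpace.MetrizableSpace K]
    (φ : C(K, X)) {D : Set (K × X)} (hD : IsOpen D) (hφD : ∀ k, (k, φ k) ∈ D) :
    ∃ (I : Finset ℕ) (π : C(K, I → ℝ)) (ρ : C(range π, X)),
      ∀ k, (k, ρ (rangeFactorization π k)) ∈ D := by
  let := TopologicalSpace.metrizableSpaceMetric K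
  obtain ⟨e, he⟩ := exists_isEmbedding_realSequences K
  let e' := he.toHomeomorph
  obtain ⟨W, hW, r, hr⟩ := hX.exists_extension (isCompact_range he.continuous).isClosed
    (φ.comp ⟨e'.symm, e'.symm.continuous⟩)
  have hre : ∀ k, ∃ hk : e k ∈ W, r ⟨e k, hk⟩ = φ k := fun k => by
    obtain ⟨hk, hrk⟩ := hr (e' k)
    exact ⟨hk, hrk.trans (congrArg φ (e'.symm_apply_apply k))⟩
  obtain ⟨I, hI⟩ := exists_finset_forall_eqOn_imp_mem he.continuous
    (D := Subtype.val '' {z : (Prod.snd ⁻¹' W : Set (K × (ℕ → ℝ))) | (z.1.1, r ⟨z.1.2, z.2⟩) ∈ D})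
    ((hW.preimage continuous_snd).isOpenMap_subtype_val _ (hD.preimage (by fun_prop)))
    fun k => by
      obtain ⟨hk, hrk⟩ := hre k
      exact ⟨⟨(k, e k), hk⟩, by simpa only [mem_ofPred_eq, hrk] using hφD k, rfl⟩
  let j : C(I → ℝ, ℕ → ℝ) := ⟨fun s i => if hi : i ∈ I then s ⟨i, hi⟩ else 0,
    continuous_pi fun i => by split_ifs <;> fun_prop⟩
  have hjD : ∀ k, ∃ hk : j (I.restrict (e k)) ∈ W, (k, r ⟨_, hk⟩) ∈ D := fun k => by
    obtain ⟨⟨z, hz⟩, hzD, heq⟩ := hI k (j (I.restrict (e k))) fun i hi => by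
      simp [j, hi]
    obtain rfl : z = _ := heq
    exact ⟨hz, hzD⟩
  have he_cont := he.continuous
  refine ⟨I, ⟨fun k => I.restrict (e k), by fun_prop⟩, ⟨fun s => r ⟨j s, ?_⟩, ?_⟩,
    fun k => (hjD k).2⟩
  · obtain ⟨_, k, rfl⟩ := s
    exact (hjD k).1
  · fun_prop

end Factorization

section Precomposition

variable {P : Type*} {X : Type u} {Y : Type v} [TopologicalSpace P] [TopologicalSpace X]
  [TopologicalSpace Y]

/-- The composition `F ∘ ρ` of a multivalued map with a map to its source. -/
def MultivaluedMap.precomp (F : MultivaluedMap X Y) (ρ : P → X) : MultivaluedMap P Y where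
  toFun p := F (ρ p)
  nonempty_apply p := F.nonempty_apply (ρ p)

theorem MultivaluedMap.IsCompactMap.precomp {F : MultivaluedMap X Y} (hF : F.IsCompactMap)
    {ρ : P → X} (hρ : Continuous ρ) : (F.precomp ρ).IsCompactMap where
  upperSemicontinuous U hU := (hF.upperSemicontinuous U hU).preimage hρ
  isCompact_apply p := hF.isCompact_apply (ρ p)

/-- The pullback along `ρ` of a fiberwise transformation, with fibers `T(ρ(p))`. -/
def FiberwiseTransformation.precomp {Y' : Type*} [TopologicalSpace Y'] {F : MultivaluedMap X Y}
    {G : MultivaluedMap X Y'} (T : FiberwiseTransformation F G) (ρ : C(P, X)) :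
    FiberwiseTransformation (F.precomp ρ) (G.precomp ρ) where
  toMap := ⟨fun q => ⟨(q.1.1, (T.toMap ⟨(ρ q.1.1, q.1.2), q.2⟩ : X × Y').2),
    T.snd_mem ⟨(ρ q.1.1, q.1.2), q.2⟩⟩, by fun_prop⟩
  fst_eq _ := rfl

namespace SingularFiltration

variable {F : MultivaluedMap X Y} {n : ℕ}

/-- The pullback along `ρ` of a singular filtration. -/
def precomp (ℱ : SingularFiltration.{u, v, w} F n) (ρ : C(P, X)) :
    SingularFiltration (F.precomp ρ) n where
  space := ℱ.space
  metrizable := ℱ.metrizable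
  separable := ℱ.separable
  map i := (ℱ.map i).precomp ρ
  trans i := (ℱ.trans i).precomp ρ
  transLast := ℱ.transLast.precomp ρ

theorem exists_approximation_comp (hX : IsANR X) (hY : ApproxNeighborhoodExtensor.{0} Y)
    (ℱ : SingularFiltration.{u, v, w} F n) (hc : ℱ.IsCompactFiltration)
    (hA : ℱ.IsApproxInftyConnected) {K : Type*} [TopologicalSpace K] [CompactSpace K]
    [TopologicalSpace.MetrizableSpace K] (φ : C(K, X)) {U : Set (K × Y)} (hU : IsOpen U)
    (hFU : ∀ k, ∀ y ∈ F (φ k), (k, y) ∈ U) : ∃ f : C(K, Y), ∀ k, (k, f k) ∈ U := by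
  have hD : IsOpen {z : K × X | ∀ q : (ℱ.map (Fin.last n)).graph,
      (q : X × ℱ.space (Fin.last n)).1 = z.2 → (z.1, (ℱ.transLast.toMap q : X × Y).2) ∈ U} :=
    isOpen_setOf_forall_fiber_mem (hc (Fin.last n)).isProperMap_fst <|
      hU.preimage (f := fun z : K × (ℱ.map (Fin.last n)).graph =>
        (z.1, (ℱ.transLast.toMap z.2 : X × Y).2)) (by fun_prop)
  obtain ⟨I, π, ρ, hρD⟩ := hX.exists_factorization_near φ hD <| by
    rintro k ⟨⟨_, y⟩, hy⟩ rfl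
    exact hFU k _ (ℱ.transLast.snd_mem ⟨_, hy⟩)
  let p : C(K, range π) := ⟨rangeFactorization π, by fun_prop⟩
  have hV : IsOpen {z : range π × Y | ∀ k, p k = z.1 → (k, z.2) ∈ U} :=
    (isOpen_setOf_forall_fiber_mem p.continuous.isProperMap (hU.preimage continuous_swap)).preimage
      continuous_swap
  obtain ⟨h, hh⟩ := (ℱ.precomp ρ).exists_approximation hY (Nat.le_add_left n _)
    ((coveringDimLE_of_isCompact (isCompact_range π.continuous)).mono (Nat.le_add_right _ n))
    (fun i => (hc i).precomp ρ.continuous) (fun s => hA.1 (ρ s))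
    (fun s k hk _ => hA.2 (ρ s) k hk) hV <| by
      rintro ⟨⟨_, y⟩, hy⟩ k rfl
      exact hρD k ⟨(ρ (p k), y), hy⟩ rfl
  exact ⟨h.comp p, fun k => hh (p k) k rfl⟩

end SingularFiltration

end Precomposition

theorem mainTheorem6_general :
    (∀ (X : Type u) [TopologicalSpace X] [TopologicalSpace.MetrizableSpace X] (Y : Type v)
        [AddCommGroup Y] [Module ℝ Y] [TopologicalSpace Y] [IsTopologicalAddGroup Y]
        [ContinuousSMul ℝ Y] [LocallyConvexSpace ℝ Y] (n : ℕ) (H : MultivaluedMap X Y)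
        (ℋ : SingularFiltration.{u, v, w} H n),
        CoveringDimLE X n → ℋ.IsCompactFiltration → ℋ.IsApproxConnected →
        ∀ U ∈ 𝓝ˢ H.graph, ∃ h : C(X, Y), ∀ x : X, (x, h x) ∈ U) ∧
    (∀ (X : Type u) [TopologicalSpace X] (Y : Type v) [TopologicalSpace Y],
        IsANR X → IsANR Y →
        ∀ (F : MultivaluedMap X Y) (n : ℕ) (ℱ : SingularFiltration.{u, v, w} F n),
        ℱ.IsCompactFiltration → ℱ.IsApproxInftyConnected →
        ∀ K : Set X, IsCompact K →
        ∀ U ∈ 𝓝ˢ (F.graphOn K), ∃ f : C(K, Y), ∀ x : K, ((x : X), f x) ∈ U) := by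
  refine ⟨fun X _ _ Y _ _ _ _ _ _ n H ℋ hdim hc hA U hU => ?_,
    fun X _ Y _ hX hY F n ℱ hc hA K hK U hU => ?_⟩
  · obtain ⟨V, hV, hHV, hVU⟩ := mem_nhdsSet_iff_exists.1 hU
    obtain ⟨h, hh⟩ := ℋ.exists_approximation (approxNeighborhoodExtensor_of_locallyConvexSpace Y)
      le_rfl hdim hc hA (fun _ _ hk hk' => absurd hk' hk.not_gt) hV
      fun p => hHV (ℋ.transLast.toMap p).2
    exact ⟨h, fun x => hVU (hh x)⟩
  · obtain ⟨V, hV, hFV, hVU⟩ := mem_nhdsSet_iff_exists.1 hU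
    have := hX.metrizable
    have : CompactSpace K := isCompact_iff_compactSpace.1 hK
    obtain ⟨f, hf⟩ := ℱ.exists_approximation_comp hX hY.approxNeighborhoodExtensor hc hA
      ⟨Subtype.val, continuous_subtype_val⟩
      (hV.preimage (f := fun z : K × Y => ((z.1 : X), z.2)) (by fun_prop))
      fun k _ hy => hFV ⟨k.2, hy⟩
    exact ⟨f, fun x => hVU (hf x)⟩

theorem mainTheorem6 :
    (∀ (X : Type u) [MetricSpace X] (Y : Type v) [NormedAddCommGroup Y] [NormedSpace ℝ Y]
        [CompleteSpace Y] (n : ℕ) (H : MultivaluedMap X Y)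
        (ℋ : SingularFiltration.{u, v, w} H n),
        CoveringDimLE X n → ℋ.IsCompactFiltration → ℋ.IsApproxConnected →
        ∀ U ∈ 𝓝ˢ H.graph, ∃ h : C(X, Y), ∀ x : X, (x, h x) ∈ U) ∧
    (∀ (X : Type u) [TopologicalSpace X] (Y : Type v) [TopologicalSpace Y],
        IsANR X → IsANR Y →
        ∀ (F : MultivaluedMap X Y) (n : ℕ) (ℱ : SingularFiltration.{u, v, w} F n),
        F.IsCompactMap → ℱ.IsCompactFiltration → ℱ.IsApproxInftyConnected →
        ∀ K : Set X, IsCompact K →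
        ∀ U ∈ 𝓝ˢ (F.graphOn K), ∃ f : C(K, Y), ∀ x : K, ((x : X), f x) ∈ U) := by
  obtain ⟨hdim, hANR⟩ := mainTheorem6_general.{u, v, w}
  exact ⟨fun X _ Y _ _ _ => hdim X Y, fun X _ Y _ hX hY F n ℱ _ => hANR X Y hX hY F n ℱ⟩
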